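/- **Theorem 1.4.** Let $N\ge 1$, write points of $\mathbb R^N$ as $x=(x_1,x')$ with $x'\in\mathbb R^{N-1}$, let $B_1(0)$ be the open unit ball, and let "measurable" mean Lebesgue measurable. Assume the following. - $(D)$: $\Omega\subset\mathbb R^N$ is open and bounded, and $(sx_1,x')\in\Omega$ for all $x\in\Omega$, $s\in[-1,1]$. - $J:\mathbb R^N\setminus\{0\}\to[0,\infty)$ is measurable and even, i.e. $J(-z)=J(z)$. - $(J1)$: $\int_{\mathbb R^N\setminus B_1(0)}J(z)\,dz+\int_{B_1(0)}|z|^2J(z)\,dz<\infty$ and $\int_{\mathbb R^N}J(z)\,dz=\infty$. - $(J2)'$: $J(s,z')\ge J(t,z')$ for all $z'\in\mathbb R^{N-1}$ and $s,t\in\mathbb R$ with $|s|\le|t|$ and $(s,z')\ne 0$. Moreover, there is $r_0>0$ such that $J(s,z')>J(t,z')$ for all $z'\in\mathbb R^{N-1}$ and $s,t\in\mathbb R$ with $|z'|\le r_0$, $|s|<|t|\le r_0$ and $(s,z')\neq0$. - $(F1)$: $f:\Omega\times\mathbb R\to\mathbb R$ is a Carathéodory function ($f(\cdot,\tau)$ is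 measurable for every $\tau\in\mathbb R$, and $f(x,\cdot)$ is continuous for almost every $x\in\Omega$) such that for every bounded $K\subset\mathbb R$ there is $L=L(K)>0$ with $\sup_{x\in\Omega}|f(x,\sigma)-f(x,\tau)|\le L|\sigma-\tau|$ for all $\sigma,\tau\in K$. - $(F2)$: $f(sx_1,x',\tau)\ge f(x,\tau)$ for all $\tau\in\mathbb R$, $x\in\Omega$, $s\in[-1,1]$. Let $$\mathcal J(u,v)=\frac12\int_{\mathbb R^N}\int_{\mathbb R^N}(u(x)-u(y))(v(x)-v(y))J(x-y)\,dx\,dy,$$ $$\mathcal D(\Omega)=\{u:\mathbb R^N\to\mathbb R \text{ measurable}:\ \mathcal J(u,u)<\infty,\ u\equiv0 \text{ on }\mathbb R^N\setminus\Omega\}.$$ Let $u\in\mathcal D(\Omega)\cap L^\infty(\Omega)$ with $u>0$ a.e. in $\Omega$ be a (weak) solution of the problem $(P)$ [$Iu=f(x,u)$ in $\Omega$, $u=0$ on $\mathbb R^N\setminus\Omega$, where $I$ is the operator associated with $\mathcal J$], that is, for every $\varphi\in\mathcal D(\Omega)$ the integral $\int_\Omega f(x,u(x))\varphi(x)\,dx$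 exists and $$\mathcal J(u,\varphi)=\int_\Omega f(x,u(x))\varphi(x)\,dx .$$ Then: 1. $u$ is symmetric in $x_1$: $u(-x_1,x')=u(x_1,x')$ for almost every $x\in\Omega$. 2. $u$ is strictly decreasing in $|x_1|$ on $\Omega$: for every $\lambda\in\mathbb R\setminus\{0\}$ and every compact set $K\subset\{x\in\Omega:\ x_1/\lambda>1\}$, $$\operatorname*{ess\,inf}_{x\in K}\,[u(2\lambda-x_1,x')-u(x)]>0 .$$ 3. Consequently, $\operatorname*{ess\,inf}_K u>0$ for every compact set $K\subset\Omega$. Here the essential infimum over a null set is $+\infty$. -/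

import Mathlib

open MeasureTheory

namespace NonlocalSymmetry

/-- Euclidean space `ℝ^N` with `N = n + 1 ≥ 1`; the first coordinate of `x` is `x 0`. -/
abbrev E (n : ℕ) : Type := EuclideanSpace ℝ (Fin (n + 1))

/-- The point `(s, z') ∈ ℝ^N` with first coordinate `s ∈ ℝ` and remaining coordinates
`z' ∈ ℝ^{N-1}`. -/
def pt {n : ℕ} (s : ℝ) (z' : EuclideanSpace ℝ (Fin n)) : E n :=
  WithLp.toLp 2 (Fin.cons s (fun i => z' i))

/-- The point `x' = (x_2, …, x_N) ∈ ℝ^{N-1}` of remaining coordinates of `x ∈ ℝ^N`. -/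
def rest {n : ℕ} (x : E n) : EuclideanSpace ℝ (Fin n) :=
  WithLp.toLp 2 (fun i => x i.succ)

/-- An even, measurable kernel `J : ℝ^N ∖ {0} → [0, ∞)`. The kernel is a total function in Lean,
whose value at `0` is never constrained. Throughout, measurability is in the sense of Lebesgue,
which is `AEMeasurable` for `volume`. -/
structure EvenKernel {n : ℕ} (J : E n → ℝ) : Prop where
  measurable : AEMeasurable J volume
  nonneg : ∀ z, z ≠ 0 → 0 ≤ J z
  even : ∀ z, z ≠ 0 → J (-z) = J z

/-- The integrability condition
`∫_{ℝ^N ∖ B_1} J + ∫_{B_1} |z|² J < ∞` and `∫_{ℝ^N} J = ∞`. -/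
def KernelIntegrability {n : ℕ} (J : E n → ℝ) : Prop :=
  (∫⁻ z in (Metric.ball (0 : E n) 1)ᶜ, ENNReal.ofReal (J z))
      + (∫⁻ z in Metric.ball (0 : E n) 1, ENNReal.ofReal (‖z‖ ^ 2 * J z)) < ⊤
    ∧ (∫⁻ z : E n, ENNReal.ofReal (J z)) = ⊤

/-- Monotonicity of the kernel in `|x_1|`, strict close to the origin. The origin, where the
kernel is not defined, is excluded; note that `(t, z') = 0` and `|s| ≤ |t|` force `(s, z') = 0`. -/
def KernelMonotone {n : ℕ} (J : E n → ℝ) : Prop :=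
  (∀ (z' : EuclideanSpace ℝ (Fin n)) (s t : ℝ), pt s z' ≠ 0 → |s| ≤ |t| →
      J (pt t z') ≤ J (pt s z'))
    ∧ ∃ r₀ : ℝ, 0 < r₀ ∧
      ∀ (z' : EuclideanSpace ℝ (Fin n)) (s t : ℝ), pt s z' ≠ 0 → ‖z'‖ ≤ r₀ →
        |s| < |t| → |t| ≤ r₀ → J (pt t z') < J (pt s z')

/-- `Ω` is an open bounded set that is Steiner symmetric in `x_1`. -/
structure SteinerDomain {n : ℕ} (Ω : Set (E n)) : Prop where
  isOpen : IsOpen Ω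
  isBounded : Bornology.IsBounded Ω
  steiner : ∀ x ∈ Ω, ∀ s ∈ Set.Icc (-1 : ℝ) 1, pt (s * x 0) (rest x) ∈ Ω

/-- `f : Ω × ℝ → ℝ` is a Carathéodory function, locally Lipschitz in the second variable,
uniformly in `x ∈ Ω`. Only the values of `f` on `Ω × ℝ` matter. -/
structure CaratheodoryLipschitz {n : ℕ} (Ω : Set (E n)) (f : E n → ℝ → ℝ) : Prop where
  measurable : ∀ τ : ℝ, AEMeasurable (fun x => f x τ) (volume.restrict Ω)
  continuous : ∀ᵐ x ∂(volume.restrict Ω), Continuous (f x)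
  lipschitz : ∀ K : Set ℝ, Bornology.IsBounded K →
    ∃ L : ℝ, 0 < L ∧ ∀ x ∈ Ω, ∀ σ ∈ K, ∀ τ ∈ K, |f x σ - f x τ| ≤ L * |σ - τ|

/-- `f` is symmetric and monotone in `x_1`:
`f (s x_1, x', τ) ≥ f (x, τ)` for `x ∈ Ω`, `s ∈ [-1, 1]`. -/
def NonlinearityMonotone {n : ℕ} (Ω : Set (E n)) (f : E n → ℝ → ℝ) : Prop :=
  ∀ τ : ℝ, ∀ x ∈ Ω, ∀ s ∈ Set.Icc (-1 : ℝ) 1, f x τ ≤ f (pt (s * x 0) (rest x)) τ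

/-- The energy `𝒥(u, u) = ½ ∬ (u(x) - u(y))² J(x - y) dx dy ∈ [0, ∞]`. -/
noncomputable def energy {n : ℕ} (J : E n → ℝ) (u : E n → ℝ) : ENNReal :=
  2⁻¹ * ∫⁻ p : E n × E n, ENNReal.ofReal ((u p.1 - u p.2) ^ 2 * J (p.1 - p.2))

/-- The bilinear form `𝒥(u, v) = ½ ∬ (u(x) - u(y)) (v(x) - v(y)) J(x - y) dx dy`, as an integral
over `ℝ^N × ℝ^N`; the integrand is integrable if `u` and `v` have finite energy. -/
noncomputable def form {n : ℕ} (J : E n → ℝ) (u v : E n → ℝ) : ℝ :=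
  (1 / 2 : ℝ) * ∫ p : E n × E n, (u p.1 - u p.2) * (v p.1 - v p.2) * J (p.1 - p.2)

/-- The space `𝒟(Ω)` of measurable `u : ℝ^N → ℝ` with `𝒥(u, u) < ∞` that vanish on `ℝ^N ∖ Ω`. -/
structure MemD {n : ℕ} (J : E n → ℝ) (Ω : Set (E n)) (u : E n → ℝ) : Prop where
  measurable : AEMeasurable u volume
  energy_lt_top : energy J u < ⊤
  eq_zero : ∀ x, x ∉ Ω → u x = 0

/-- `u` is a (weak) solution of `I u = f(x, u)` in `Ω`, `u = 0` on `ℝ^N ∖ Ω`. -/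
structure IsSolution {n : ℕ} (J : E n → ℝ) (Ω : Set (E n)) (f : E n → ℝ → ℝ)
    (u : E n → ℝ) : Prop where
  memD : MemD J Ω u
  integrable : ∀ φ : E n → ℝ, MemD J Ω φ → IntegrableOn (fun x => f x (u x) * φ x) Ω
  eq : ∀ φ : E n → ℝ, MemD J Ω φ → form J u φ = ∫ x in Ω, f x (u x) * φ x

/-- The essential infimum of `g` over `K`, in `[-∞, ∞]` (it is `∞` if `K` is a null set). -/
noncomputable def essInfOn {n : ℕ} (g : E n → ℝ) (K : Set (E n)) : EReal :=
  essInf (fun x => (g x : EReal)) (volume.restrict K)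

/-- `u(-x_1, x') = u(x_1, x')` for almost every `x ∈ Ω`. -/
def SymmetricFirst {n : ℕ} (Ω : Set (E n)) (u : E n → ℝ) : Prop :=
  ∀ᵐ x ∂(volume.restrict Ω), u (pt (-(x 0)) (rest x)) = u x

/-- `u` is strictly decreasing in `|x_1|` on `Ω`: for every `l ≠ 0` and every compact
`K ⊆ {x ∈ Ω : x_1 / l > 1}`, the essential infimum over `x ∈ K` of `u(2l - x_1, x') - u(x)` is
positive. -/
def StrictlyDecreasingFirst {n : ℕ} (Ω : Set (E n)) (u : E n → ℝ) : Prop :=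
  ∀ l : ℝ, l ≠ 0 → ∀ K : Set (E n), IsCompact K → K ⊆ {x | x ∈ Ω ∧ 1 < x 0 / l} →
    0 < essInfOn (fun x => u (pt (2 * l - x 0) (rest x)) - u x) K

end NonlocalSymmetry

open NonlocalSymmetry

/-!
# Symmetry of positive solutions of nonlocal equations by the method of moving planes

For a hyperplane `{x_1 = l}` with `l ≥ 0` let `w = reflDiff l u` be the difference of the reflected
solution and the solution. It is antisymmetric, and the monotonicity of `f` in `|x_1|` makes it a
supersolution of a linear equation with bounded zeroth order coefficient on the part of `Ω` in the
half space `{x_1 > l}` (`PositiveSolution.le_form_reflDiff`). Everything rests on one energy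
inequality (`form_halfNeg_le`): if `ψ` is the negative part of an antisymmetric `v` on the half
space, then `form J v ψ ≤ -form J ψ ψ`, with an additional negative term that measures the jumps
from `{ψ ≠ 0}` into sets where `v` is positive. It holds because a jump within the half space is at
least as likely as the jump to the reflected point.

Two maximum principles follow.

* As the kernel has infinite mass, the energy controls every multiple of the `L²` norm on sets of
  small measure (`exists_poincare`). Hence `w ≥ 0` on the half space as soon as `{w < 0}` has small
  measure there (`PositiveSolution.exists_reflDiff_nonneg_of_measure_lt`).
* If `w ≥ 0` on the half space, then near each point of `Ω` either `w` is bounded below by a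
  positive constant or it vanishes in all points within the range of strict monotonicity of the
  kernel (`PositiveSolution.exists_le_reflDiff_of_not_ae_eq_zero`). This follows by comparison with
  a small multiple of an antisymmetrized truncated paraboloid: as the paraboloid is semiconvex, the
  operator applied to it is bounded above (`form_le_of_second_difference_le`), and the jumps into a
  set where `w` is large compensate for that. For `l > 0` vanishing is impossible, because it
  would spread to the right until it reaches points outside of `Ω` whose reflection lies in `Ω`,
  where `w = u ∘ refl l` is positive (`PositiveSolution.exists_le_reflDiff`).

Consequently the set of `l > 0` with `w ≥ 0` is open and closed in `(0, ∞)` and contains all large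
`l`, so it is everything, and `w ≥ 0` for `l = 0`, too. Applied to `u` and to its reflection at
`{x_1 = 0}`, the case `l = 0` gives symmetry; the strong maximum principle and compactness give
strict monotonicity. A point of `Ω` is the reflection of a point of `Ω` farther to the right at some
`{x_1 = l}` with `l > 0`, whence the positive lower bound of `u`.
-/

namespace NonlocalSymmetry

open Filter Topology
open scoped ENNReal

/-! ### Reflections and coordinates -/

section

variable {n : ℕ}

@[simp] lemma pt_zero (s : ℝ) (z : EuclideanSpace ℝ (Fin n)) : (pt s z : E n) 0 = s := rfl

@[simp] lemma rest_pt (s : ℝ) (z : EuclideanSpace ℝ (Fin n)) : rest (pt s z : E n) = z := by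
  ext i; simp [rest, pt]

@[simp] lemma pt_rest (x : E n) : pt (x 0) (rest x) = x := by
  ext i
  refine Fin.cases ?_ (fun j => ?_) i <;> simp [rest, pt]

lemma ext_first_rest {x y : E n} (h0 : x 0 = y 0) (h : rest x = rest y) : x = y := by
  rw [← pt_rest x, ← pt_rest y, h0, h]

@[simp] lemma rest_sub (x y : E n) : rest (x - y) = rest x - rest y := by ext i; simp [rest]

lemma norm_sq_eq_first_add_rest (x : E n) : ‖x‖ ^ 2 = x 0 ^ 2 + ‖rest x‖ ^ 2 := by
  rw [EuclideanSpace.norm_sq_eq, EuclideanSpace.norm_sq_eq, Fin.sum_univ_succ]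
  simp [rest]

lemma norm_rest_le (x : E n) : ‖rest x‖ ≤ ‖x‖ := by
  have := norm_sq_eq_first_add_rest x
  exact (abs_le_of_sq_le_sq' (by nlinarith [sq_nonneg (x 0)]) (norm_nonneg _)).2

lemma abs_first_le (x : E n) : |x 0| ≤ ‖x‖ := by
  have := norm_sq_eq_first_add_rest x
  exact abs_le_of_sq_le_sq (by nlinarith [sq_nonneg ‖rest x‖]) (norm_nonneg _)

/-- Reflection of `ℝ^N` at the hyperplane `{x_1 = l}`. -/
def refl (l : ℝ) (x : E n) : E n := pt (2 * l - x 0) (rest x)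

@[simp] lemma refl_first (l : ℝ) (x : E n) : refl l x 0 = 2 * l - x 0 := rfl

@[simp] lemma rest_refl (l : ℝ) (x : E n) : rest (refl l x) = rest x := by simp [refl]

@[simp] lemma refl_refl (l : ℝ) (x : E n) : refl l (refl l x) = x :=
  ext_first_rest (by simp) (by simp)

lemma refl_sub_refl (l : ℝ) (x y : E n) : refl l x - refl l y = refl 0 (x - y) :=
  ext_first_rest (by simp) (by simp)

lemma norm_refl_zero (x : E n) : ‖refl 0 x‖ = ‖x‖ := by
  have h := norm_sq_eq_first_add_rest (refl 0 x)
  rw [refl_first, rest_refl, mul_zero, zero_sub, neg_sq, ← norm_sq_eq_first_add_rest] at h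
  exact (pow_left_inj₀ (norm_nonneg _) (norm_nonneg _) two_ne_zero).1 h

lemma isometry_refl (l : ℝ) : Isometry (refl l : E n → E n) :=
  Isometry.of_dist_eq fun x y => by
    rw [dist_eq_norm, dist_eq_norm, refl_sub_refl, norm_refl_zero]

lemma continuous_refl (l : ℝ) : Continuous (refl l : E n → E n) := (isometry_refl l).continuous

lemma continuous_uncurry_refl : Continuous (fun p : ℝ × E n => refl p.1 p.2) := by
  have : (fun p : ℝ × E n => refl p.1 p.2)
      = fun p : ℝ × E n => refl 0 p.2 + (2 * p.1) • pt 1 0 := by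
    ext p : 1
    refine ext_first_rest (by simp; ring) ?_
    ext i
    simp [rest, refl, pt]
  rw [this]
  have := continuous_refl (n := n) 0
  fun_prop

lemma measurable_refl (l : ℝ) : Measurable (refl l : E n → E n) := (continuous_refl l).measurable

lemma measurePreserving_refl (l : ℝ) : MeasurePreserving (refl l : E n → E n) := by
  let e : E n ≃ₗᵢ[ℝ] E n := LinearIsometryEquiv.piLpCongrRight 2
    (fun i => if i = 0 then LinearIsometryEquiv.neg ℝ else LinearIsometryEquiv.refl ℝ ℝ)
  have h : (refl l : E n → E n) = fun x => e x + (2 * l) • pt 1 0 := by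
    ext x i
    refine Fin.cases ?_ (fun j => ?_) i
    · simp [refl, e, pt]; ring
    · simp [refl, e, pt, rest]
  rw [h]
  exact (measurePreserving_add_right volume _).comp e.measurePreserving

lemma measurableEmbedding_refl (l : ℝ) : MeasurableEmbedding (refl l : E n → E n) :=
  (isometry_refl l).isClosedEmbedding.measurableEmbedding

lemma continuous_first : Continuous (fun x : E n => x 0) := by fun_prop

lemma continuous_rest : Continuous (rest : E n → EuclideanSpace ℝ (Fin n)) :=
  LipschitzWith.continuous (K := 1) (LipschitzWith.of_dist_le_mul fun x y => by
    rw [dist_eq_norm, dist_eq_norm, ← rest_sub]; simpa using norm_rest_le (x - y))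

lemma volume_hyperplane (l : ℝ) : volume {x : E n | x 0 = l} = 0 := by
  have h := (EuclideanSpace.volume_preserving_symm_measurableEquiv_toLp (Fin (n + 1))).symm
  rw [← h.measure_preimage_equiv]
  exact Measure.pi_hyperplane (fun _ : Fin (n + 1) => (volume : Measure ℝ)) 0 l

/-- Composition with a continuous family of measure preserving maps is continuous in `L¹`. -/
lemma tendsto_lintegral_comp_sub {Z : Type*} [TopologicalSpace Z] {Φ : Z → E n → E n}
    (hΦ : Continuous (fun p : Z × E n => Φ p.1 p.2)) (hmp : ∀ z, MeasurePreserving (Φ z))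
    {g : E n → ℝ} (hg : Integrable g) (z₀ : Z) :
    Tendsto (fun z => ∫⁻ x, ‖g (Φ z x) - g (Φ z₀ x)‖ₑ) (𝓝 z₀) (𝓝 0) := by
  let G : C(Z, C(E n, E n)) := ContinuousMap.curry ⟨fun p : Z × E n => Φ p.1 p.2, hΦ⟩
  have hG : ∀ z, MeasurePreserving (G z) := hmp
  have hgL : MemLp g 1 := memLp_one_iff_integrable.2 hg
  have key : Tendsto (fun z => Lp.compMeasurePreserving (G z) (hG z) (hgL.toLp g)) (𝓝 z₀)
      (𝓝 (Lp.compMeasurePreserving (G z₀) (hG z₀) (hgL.toLp g))) :=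
    (Continuous.compMeasurePreservingLp (f := fun _ : Z => hgL.toLp g) continuous_const
      G.continuous hG (by simp)).tendsto z₀
  rw [Lp.tendsto_Lp_iff_tendsto_eLpNorm'] at key
  refine key.congr fun z => ?_
  rw [eLpNorm_one_eq_lintegral_enorm]
  refine lintegral_congr_ae ?_
  have h (z : Z) : (Lp.compMeasurePreserving (G z) (hG z) (hgL.toLp g) : E n → ℝ)
      =ᵐ[volume] fun x => g (Φ z x) := by
    refine (Lp.coeFn_compMeasurePreserving _ (hG z)).trans ?_
    exact (hG z).quasiMeasurePreserving.ae_eq_comp hgL.coeFn_toLp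
  filter_upwards [h z, h z₀] with x h1 h2
  rw [Pi.sub_apply, h1, h2]

end

/-! ### Kernels, finite energy and the Poincaré inequality -/

section

variable {n : ℕ}

/-- An even kernel that is invariant under `refl 0`, monotone in `|x_1|`, and subject to the
integrability condition of a Lévy measure of infinite mass. In contrast to the hypotheses on `J` in
the theorem, nonnegativity and the symmetries hold at the origin, too; this is no restriction, as
the value at the origin can be changed to `0`. -/
structure LevyKernel (J : E n → ℝ) : Prop where
  aemeasurable : AEMeasurable J
  nonneg : ∀ z, 0 ≤ J z
  even : ∀ z, J (-z) = J z
  refl_zero : ∀ z, J (refl 0 z) = J z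
  mono : ∀ z y, z ≠ 0 → rest z = rest y → |z 0| ≤ |y 0| → J y ≤ J z
  integrable : Integrable fun z => min 1 (‖z‖ ^ 2) * J z
  lintegral_eq_top : ∫⁻ z, ENNReal.ofReal (J z) = ⊤

/-- `v` is measurable and has finite energy with respect to the kernel `J`. -/
structure FiniteEnergy (J : E n → ℝ) (v : E n → ℝ) : Prop where
  measurable : Measurable v
  integrable : Integrable fun p : E n × E n => (v p.1 - v p.2) ^ 2 * J (p.1 - p.2)

namespace LevyKernel

variable {J : E n → ℝ}

lemma refl_sub (hJ : LevyKernel J) (l : ℝ) (x y : E n) : J (refl l x - refl l y) = J (x - y) := by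
  rw [refl_sub_refl, hJ.refl_zero]

lemma refl_sub' (hJ : LevyKernel J) (l : ℝ) (x y : E n) : J (refl l x - y) = J (x - refl l y) := by
  rw [← hJ.refl_sub l x, refl_refl]

lemma sub_comm (hJ : LevyKernel J) (x y : E n) : J (x - y) = J (y - x) := by
  rw [← hJ.even, neg_sub]

/-- The distance of two points on the same side of the hyperplane `{x_1 = l}` increases when one of
them is reflected, so the kernel decreases. -/
lemma sub_refl_le (hJ : LevyKernel J) {l : ℝ} {x y : E n} (hx : l ≤ x 0) (hy : l ≤ y 0)
    (hxy : x ≠ y) : J (x - refl l y) ≤ J (x - y) := by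
  refine hJ.mono _ _ (sub_ne_zero.2 hxy) (by simp) ?_
  simp only [PiLp.sub_apply, refl_first]
  rw [abs_le]
  constructor <;> cases abs_cases (x 0 - (2 * l - y 0)) <;> linarith

lemma aemeasurable_sub (hJ : LevyKernel J) :
    AEMeasurable fun p : E n × E n => J (p.1 - p.2) :=
  hJ.aemeasurable.comp_quasiMeasurePreserving (quasiMeasurePreserving_sub_of_right_invariant _ _)

lemma aemeasurable_sub_left (hJ : LevyKernel J) (x : E n) : AEMeasurable fun y => J (x - y) :=
  hJ.aemeasurable.comp_quasiMeasurePreserving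
    (quasiMeasurePreserving_sub_left_of_right_invariant _ x)

lemma min_sq_mul_nonneg (hJ : LevyKernel J) (z : E n) : 0 ≤ min 1 (‖z‖ ^ 2) * J z :=
  mul_nonneg (le_min zero_le_one (sq_nonneg _)) (hJ.nonneg z)

/-- The kernel is integrable away from the origin. -/
lemma integrable_far (hJ : LevyKernel J) {r : ℝ} (hr : 0 < r) :
    Integrable ({z : E n | r ≤ ‖z‖}.indicator J) := by
  have hm : MeasurableSet {z : E n | r ≤ ‖z‖} := measurableSet_le measurable_const measurable_norm
  have hc : 0 < min 1 (r ^ 2) := lt_min one_pos (by positivity)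
  refine (hJ.integrable.const_mul (min 1 (r ^ 2))⁻¹).mono'
    (hJ.aemeasurable.indicator hm).aestronglyMeasurable (ae_of_all _ fun z => ?_)
  have h0 := hJ.min_sq_mul_nonneg z
  by_cases hz : r ≤ ‖z‖
  · rw [Set.indicator_of_mem (by exact hz), Real.norm_of_nonneg (hJ.nonneg z), ← div_eq_inv_mul,
      le_div_iff₀ hc, mul_comm]
    gcongr
    exact hJ.nonneg z
  · rw [Set.indicator_of_notMem (by exact hz), norm_zero]
    positivity

/-- Sets of small measure do not capture the mass of the kernel, as its total mass is infinite. -/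
lemma exists_forall_le_lintegral_compl (hJ : LevyKernel J) (C : ℝ≥0∞) (hC : C ≠ ⊤) :
    ∃ δ : ℝ≥0∞, 0 < δ ∧ ∀ U : Set (E n), MeasurableSet U → volume U < δ → ∀ x,
      C ≤ ∫⁻ y in Uᶜ, ENNReal.ofReal (J (x - y)) := by
  let A : ℕ → Set (E n) := fun k => {z | 1 / ((k : ℝ) + 1) ≤ ‖z‖}
  have hA : ∀ k, MeasurableSet (A k) := fun k => measurableSet_le measurable_const measurable_norm
  have hmono : Monotone A := fun k m hkm z hz => (by
    have : (k : ℝ) ≤ m := by exact_mod_cast hkm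
    have h0 : (0 : ℝ) < k + 1 := by positivity
    exact (one_div_le_one_div_of_le h0 (by linarith)).trans hz)
  have hU : ⋃ k, A k = {0}ᶜ := by
    ext z
    simp only [Set.mem_iUnion, Set.mem_compl_iff, Set.mem_singleton_iff]
    refine ⟨?_, fun hz => ?_⟩
    · rintro ⟨k, hk⟩ rfl
      have : (0 : ℝ) < 1 / ((k : ℝ) + 1) := by positivity
      exact absurd hk (by simpa [A] using this)
    · obtain ⟨k, hk⟩ := exists_nat_one_div_lt (norm_pos_iff.2 hz)
      exact ⟨k, hk.le⟩
  have hsup : ⨆ k, ∫⁻ z in A k, ENNReal.ofReal (J z) = ⊤ := by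
    rw [← setLIntegral_iUnion_of_directed _ hmono.directed_le, hU, restrict_compl_singleton,
      hJ.lintegral_eq_top]
  obtain ⟨k, hk⟩ : ∃ k, C + 1 < ∫⁻ z in A k, ENNReal.ofReal (J z) := by
    rw [← lt_iSup_iff, hsup]
    exact ENNReal.add_lt_top.2 ⟨hC.lt_top, ENNReal.one_lt_top⟩
  have hfin : ∫⁻ z in A k, ENNReal.ofReal (J z) ≠ ⊤ := by
    have := (integrable_indicator_iff (hA k)).1
      (hJ.integrable_far (r := 1 / ((k : ℝ) + 1)) (by positivity))
    exact ((hasFiniteIntegral_iff_ofReal (ae_of_all _ hJ.nonneg)).1 this.2).ne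
  obtain ⟨δ, hδ, hsmall⟩ := exists_pos_setLIntegral_lt_of_measure_lt hfin one_ne_zero
  refine ⟨δ, hδ, fun U hU hUδ x => ?_⟩
  have hmp := Measure.measurePreserving_sub_left (volume : Measure (E n)) x
  have hme : MeasurableEmbedding (fun y : E n => x - y) :=
    (Homeomorph.subLeft x).measurableEmbedding
  let V : Set (E n) := (fun y => x - y) ⁻¹' U
  have hV : MeasurableSet V := hU.preimage hmp.measurable
  have h1 : ∫⁻ y in Uᶜ, ENNReal.ofReal (J (x - y)) = ∫⁻ z in Vᶜ, ENNReal.ofReal (J z) := by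
    rw [← hmp.setLIntegral_comp_preimage_emb hme]
    simp only [sub_sub_cancel]
    rfl
  have h2 : ∫⁻ z in V, ENNReal.ofReal (J z) ∂(volume.restrict (A k)) < 1 := by
    refine hsmall V ((Measure.restrict_apply_le _ _).trans_lt ?_)
    rwa [hmp.measure_preimage hU.nullMeasurableSet]
  rw [h1]
  have h3 : C + 1 ≤ ∫⁻ z in Vᶜ, ENNReal.ofReal (J z) ∂(volume.restrict (A k)) + 1 := by
    refine hk.le.trans ?_
    rw [← lintegral_add_compl _ hV, add_comm]
    gcongr
  refine ((ENNReal.add_le_add_iff_right ENNReal.one_ne_top).1 h3).trans ?_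
  exact lintegral_mono' (Measure.restrict_mono_measure Measure.restrict_le_self _) le_rfl

end LevyKernel

variable {J v : E n → ℝ}

lemma sq_diff_mul_nonneg (hJ : LevyKernel J) (v : E n → ℝ) (p : E n × E n) :
    0 ≤ (v p.1 - v p.2) ^ 2 * J (p.1 - p.2) := mul_nonneg (sq_nonneg _) (hJ.nonneg _)

lemma aestronglyMeasurable_form (hJ : LevyKernel J) {v ψ : E n → ℝ} (hv : Measurable v)
    (hψ : Measurable ψ) : AEStronglyMeasurable
      fun p : E n × E n => (v p.1 - v p.2) * (ψ p.1 - ψ p.2) * J (p.1 - p.2) :=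
  (((hv.comp measurable_fst).sub (hv.comp measurable_snd)).mul
    ((hψ.comp measurable_fst).sub (hψ.comp measurable_snd))).aemeasurable.mul
    hJ.aemeasurable_sub |>.aestronglyMeasurable

lemma finiteEnergy_iff_energy_lt_top (hJ : LevyKernel J) (hv : Measurable v) :
    FiniteEnergy J v ↔ energy J v < ⊤ := by
  have h : energy J v < ⊤ ↔
      ∫⁻ p : E n × E n, ENNReal.ofReal ((v p.1 - v p.2) ^ 2 * J (p.1 - p.2)) < ⊤ := by
    rw [energy, ENNReal.mul_lt_top_iff]
    refine ⟨?_, fun h => Or.inl ⟨by simp, h⟩⟩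
    rintro (h | h | h)
    · exact h.2
    · simp at h
    · simp [h]
  rw [h, ← hasFiniteIntegral_iff_ofReal (ae_of_all _ (sq_diff_mul_nonneg hJ v))]
  refine ⟨fun h => h.2.2, fun h => ⟨hv, ?_, h⟩⟩
  simpa only [sq] using aestronglyMeasurable_form hJ hv hv

/-- Cauchy-Schwarz, qualitatively: `form J u v` is a convergent integral. -/
lemma FiniteEnergy.integrable_mul (hJ : LevyKernel J) {v ψ : E n → ℝ} (hv : FiniteEnergy J v)
    (hψ : FiniteEnergy J ψ) :
    Integrable fun p : E n × E n => (v p.1 - v p.2) * (ψ p.1 - ψ p.2) * J (p.1 - p.2) := by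
  refine (hv.integrable.add hψ.integrable).mono'
    (aestronglyMeasurable_form hJ hv.measurable hψ.measurable) (ae_of_all _ fun p => ?_)
  simp only [Pi.add_apply]
  rw [norm_mul, Real.norm_of_nonneg (hJ.nonneg _), ← add_mul]
  gcongr
  · exact hJ.nonneg _
  · rw [Real.norm_eq_abs, abs_le]
    constructor <;> nlinarith [sq_nonneg (v p.1 - v p.2 + (ψ p.1 - ψ p.2)),
      sq_nonneg (v p.1 - v p.2 - (ψ p.1 - ψ p.2))]

lemma FiniteEnergy.sub (hJ : LevyKernel J) {v ψ : E n → ℝ} (hv : FiniteEnergy J v)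
    (hψ : FiniteEnergy J ψ) : FiniteEnergy J (v - ψ) := by
  refine ⟨hv.measurable.sub hψ.measurable, ?_⟩
  refine ((hv.integrable.add hψ.integrable).sub
    ((hv.integrable_mul hJ hψ).const_mul 2)).congr (ae_of_all _ fun p => ?_)
  simp only [Pi.add_apply, Pi.sub_apply]
  ring

lemma FiniteEnergy.const_mul {v : E n → ℝ} (hv : FiniteEnergy J v) (c : ℝ) :
    FiniteEnergy J (fun x => c * v x) := by
  refine ⟨hv.measurable.const_mul c, (hv.integrable.const_mul (c ^ 2)).congr
    (ae_of_all _ fun p => ?_)⟩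
  simp only
  ring

lemma measurePreserving_prod_refl (l : ℝ) :
    MeasurePreserving (Prod.map (refl l) (refl l) : E n × E n → E n × E n) :=
  (measurePreserving_refl l).prod (measurePreserving_refl l)

lemma measurePreserving_refl_snd (l : ℝ) :
    MeasurePreserving (Prod.map id (refl l) : E n × E n → E n × E n) :=
  (MeasurePreserving.id _).prod (measurePreserving_refl l)

lemma measurableEmbedding_prod_refl (l : ℝ) :
    MeasurableEmbedding (Prod.map (refl l) (refl l) : E n × E n → E n × E n) :=
  (measurableEmbedding_refl l).prodMap (measurableEmbedding_refl l)

lemma measurableEmbedding_refl_snd (l : ℝ) :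
    MeasurableEmbedding (Prod.map id (refl l) : E n × E n → E n × E n) :=
  MeasurableEmbedding.id.prodMap (measurableEmbedding_refl l)

lemma FiniteEnergy.comp_refl (hJ : LevyKernel J) (hv : FiniteEnergy J v) (l : ℝ) :
    FiniteEnergy J (fun x => v (refl l x)) := by
  refine ⟨hv.measurable.comp (measurable_refl l), ?_⟩
  have := ((measurePreserving_prod_refl l).integrable_comp_emb
    (measurableEmbedding_prod_refl l)).2 hv.integrable
  refine this.congr (ae_of_all _ fun p => ?_)
  simp [hJ.refl_sub]

lemma form_comp_refl (hJ : LevyKernel J) (v ψ : E n → ℝ) (l : ℝ) :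
    form J (fun x => v (refl l x)) ψ = form J v (fun x => ψ (refl l x)) := by
  unfold form
  rw [← (measurePreserving_prod_refl l).integral_comp (measurableEmbedding_prod_refl l)]
  simp [hJ.refl_sub]

lemma form_sub_left (hJ : LevyKernel J) {v θ ψ : E n → ℝ} (hv : FiniteEnergy J v)
    (hθ : FiniteEnergy J θ) (hψ : FiniteEnergy J ψ) :
    form J (v - θ) ψ = form J v ψ - form J θ ψ := by
  unfold form
  rw [← mul_sub, ← integral_sub (hv.integrable_mul hJ hψ) (hθ.integrable_mul hJ hψ)]
  congr 2 with p
  simp only [Pi.sub_apply]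
  ring

lemma form_const_mul_left (c : ℝ) (v ψ : E n → ℝ) :
    form J (fun x => c * v x) ψ = c * form J v ψ := by
  unfold form
  have h : (fun p : E n × E n => (c * v p.1 - c * v p.2) * (ψ p.1 - ψ p.2) * J (p.1 - p.2))
      = fun p => c * ((v p.1 - v p.2) * (ψ p.1 - ψ p.2) * J (p.1 - p.2)) := by
    funext p
    ring
  rw [h, integral_const_mul]
  ring

lemma form_self_nonneg (hJ : LevyKernel J) (ψ : E n → ℝ) : 0 ≤ form J ψ ψ :=
  mul_nonneg (by norm_num) (integral_nonneg fun p => mul_nonneg (mul_self_nonneg _) (hJ.nonneg _))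

/-- Poincaré inequality: on sets of small measure the energy controls any multiple of the
square of the `L²` norm. -/
lemma exists_poincare (hJ : LevyKernel J) (C : ℝ) :
    ∃ δ : ℝ≥0∞, 0 < δ ∧ ∀ ψ : E n → ℝ, FiniteEnergy J ψ → volume {x | ψ x ≠ 0} < δ →
      Integrable (fun x => ψ x ^ 2) → C * ∫ x, ψ x ^ 2 ≤ form J ψ ψ := by
  obtain ⟨δ, hδ, h⟩ := hJ.exists_forall_le_lintegral_compl (ENNReal.ofReal (2 * C))
    ENNReal.ofReal_ne_top
  refine ⟨δ, hδ, fun ψ hψ hsm hint => ?_⟩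
  rcases lt_or_ge C 0 with hC | hC
  · exact (mul_nonpos_of_nonpos_of_nonneg hC.le (integral_nonneg fun x => sq_nonneg _)).trans
      (form_self_nonneg hJ ψ)
  let U : Set (E n) := {x | ψ x ≠ 0}
  have hU : MeasurableSet U := hψ.measurable (measurableSet_singleton 0).compl
  have hle : ENNReal.ofReal (2 * C) * ∫⁻ x, ENNReal.ofReal (ψ x ^ 2) ≤
      ∫⁻ p : E n × E n, ENNReal.ofReal ((ψ p.1 - ψ p.2) ^ 2 * J (p.1 - p.2)) := by
    rw [Measure.volume_eq_prod, lintegral_prod _ hψ.integrable.1.aemeasurable.ennreal_ofReal,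
      ← lintegral_const_mul _ (by have := hψ.measurable; fun_prop)]
    refine lintegral_mono fun x => ?_
    calc ENNReal.ofReal (2 * C) * ENNReal.ofReal (ψ x ^ 2)
        ≤ (∫⁻ y in Uᶜ, ENNReal.ofReal (J (x - y))) * ENNReal.ofReal (ψ x ^ 2) := by
          gcongr; exact h U hU hsm x
      _ = ∫⁻ y in Uᶜ, ENNReal.ofReal ((ψ x - ψ y) ^ 2 * J (x - y)) := by
          rw [mul_comm, ← lintegral_const_mul'' _
            (hJ.aemeasurable_sub_left x).ennreal_ofReal.restrict]
          refine setLIntegral_congr_fun hU.compl fun y hy => ?_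
          have : ψ y = 0 := by simpa [U] using hy
          simp only [this, sub_zero]
          rw [ENNReal.ofReal_mul (sq_nonneg _)]
      _ ≤ _ := setLIntegral_le_lintegral _ _
  rw [← ofReal_integral_eq_lintegral_ofReal hint (ae_of_all _ fun x => sq_nonneg _),
    ← ofReal_integral_eq_lintegral_ofReal hψ.integrable (ae_of_all _ (sq_diff_mul_nonneg hJ ψ)),
    ← ENNReal.ofReal_mul (by positivity), ENNReal.ofReal_le_ofReal_iff
      (integral_nonneg (sq_diff_mul_nonneg hJ ψ))] at hle
  have : form J ψ ψ
      = 1 / 2 * ∫ p : E n × E n, (ψ p.1 - ψ p.2) ^ 2 * J (p.1 - p.2) := by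
    simp only [form, sq]
  linarith

end

/-! ### The energy inequality for antisymmetric functions -/

section

variable {n : ℕ} {J v : E n → ℝ}

/-- The negative part of `v` on the half space `{x_1 > l}`, extended by zero. -/
noncomputable def halfNeg (l : ℝ) (v : E n → ℝ) (x : E n) : ℝ :=
  if l < x 0 then max (-v x) 0 else 0

lemma halfNeg_of_lt {l : ℝ} {x : E n} (hx : l < x 0) : halfNeg l v x = max (-v x) 0 := if_pos hx

lemma halfNeg_of_le {l : ℝ} {x : E n} (hx : x 0 ≤ l) : halfNeg l v x = 0 := if_neg hx.not_gt

lemma halfNeg_nonneg (l : ℝ) (v : E n → ℝ) (x : E n) : 0 ≤ halfNeg l v x := by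
  unfold halfNeg; split_ifs <;> simp

lemma halfNeg_ne_zero_iff {l : ℝ} {x : E n} : halfNeg l v x ≠ 0 ↔ l < x 0 ∧ v x < 0 := by
  rcases lt_or_ge l (x 0) with h | h
  · rw [halfNeg_of_lt h]
    rcases lt_or_ge (v x) 0 with h' | h'
    · rw [max_eq_left (by linarith)]
      exact ⟨fun _ => ⟨h, h'⟩, fun _ => by linarith⟩
    · rw [max_eq_right (by linarith)]
      simp [h'.not_gt]
  · rw [halfNeg_of_le h]
    simp [h.not_gt]

lemma halfNeg_eq_neg {l : ℝ} {x : E n} (h : halfNeg l v x ≠ 0) : halfNeg l v x = -v x := by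
  obtain ⟨h1, h2⟩ := halfNeg_ne_zero_iff.1 h
  rw [halfNeg_of_lt h1, max_eq_left (by linarith)]

lemma measurable_halfNeg (hv : Measurable v) (l : ℝ) : Measurable (halfNeg l v) :=
  Measurable.ite (measurableSet_lt measurable_const continuous_first.measurable)
    (hv.neg.max measurable_const) measurable_const

/-- Cutting off an antisymmetric function of finite energy at the hyperplane of antisymmetry
preserves finiteness of the energy. -/
lemma FiniteEnergy.halfNeg (hJ : LevyKernel J) (hv : FiniteEnergy J v) {l : ℝ}
    (hanti : ∀ x, v (refl l x) = -v x) : FiniteEnergy J (halfNeg l v) := by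
  refine ⟨measurable_halfNeg hv.measurable l, ?_⟩
  have hm := measurable_halfNeg hv.measurable l
  have hR := ((measurePreserving_refl_snd (n := n) l).integrable_comp_emb
    (measurableEmbedding_refl_snd l)).2 hv.integrable
  refine (hv.integrable.add hR).mono' (by
    simpa only [sq] using aestronglyMeasurable_form hJ hm hm) (ae_of_all _ fun p => ?_)
  obtain ⟨x, y⟩ := p
  rw [Real.norm_of_nonneg (sq_diff_mul_nonneg hJ _ _)]
  simp only [Pi.add_apply, Function.comp_apply, Prod.map_apply, id, hanti, sub_neg_eq_add]
  -- on opposite sides of the hyperplane, `2 a ^ 2 ≤ (a - b) ^ 2 + (a + b) ^ 2` distributes the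
  -- square over the point and its reflection
  have key (a b s A B : ℝ) (hs : s ^ 2 ≤ a ^ 2) (hA : 0 ≤ A) (hAB : A ≤ B) :
      s ^ 2 * A ≤ (a - b) ^ 2 * A + (a + b) ^ 2 * B := by
    nlinarith [mul_le_mul_of_nonneg_left hAB (sq_nonneg (a + b)), mul_nonneg (sq_nonneg b) hA,
      mul_le_mul_of_nonneg_right hs hA, mul_nonneg (sq_nonneg a) hA]
  have hneg (x : E n) : (NonlocalSymmetry.halfNeg l v x) ^ 2 ≤ v x ^ 2 := by
    by_cases h : NonlocalSymmetry.halfNeg l v x = 0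
    · rw [h, zero_pow two_ne_zero]; exact sq_nonneg _
    · rw [halfNeg_eq_neg h, neg_sq]
  have h0 := hJ.nonneg (x - y)
  have h1 := hJ.nonneg (x - refl l y)
  rcases lt_or_ge l (x 0) with hx | hx <;> rcases lt_or_ge l (y 0) with hy | hy
  · rw [halfNeg_of_lt hx, halfNeg_of_lt hy]
    have : (max (-v x) 0 - max (-v y) 0) ^ 2 ≤ (v x - v y) ^ 2 := by
      rw [← sq_abs, ← sq_abs (v x - v y)]
      have := abs_max_sub_max_le_abs (-v x) (-v y) 0
      rw [show -v x - -v y = -(v x - v y) by ring, abs_neg] at this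
      gcongr
    nlinarith [mul_le_mul_of_nonneg_right this h0, mul_nonneg (sq_nonneg (v x + v y)) h1]
  · rw [halfNeg_of_le hy, sub_zero]
    by_cases hxy : x = refl l y
    · have : v y = -v x := by rw [hxy, hanti, neg_neg]
      rw [this]
      nlinarith [mul_le_mul_of_nonneg_right (hneg x) h0, mul_nonneg (sq_nonneg (v x)) h0]
    · refine key _ _ _ _ _ (hneg x) h0 ?_
      have := hJ.sub_refl_le (l := l) (y := refl l y) hx.le (by simp; linarith) hxy
      rwa [refl_refl] at this
  · rw [halfNeg_of_le hx, zero_sub, neg_sq]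
    by_cases hxy : x = refl l y
    · have : v x = -v y := by rw [hxy, hanti]
      rw [this]
      nlinarith [mul_le_mul_of_nonneg_right (hneg y) h0, mul_nonneg (sq_nonneg (v y)) h0]
    · have hxy' : y ≠ refl l x := fun h => hxy (by rw [h, refl_refl])
      have := hJ.sub_refl_le (l := l) (y := refl l x) hy.le (by simp; linarith) hxy'
      rw [refl_refl, hJ.sub_comm y x, hJ.sub_comm y, hJ.refl_sub'] at this
      have := key (v y) (v x) _ _ _ (hneg y) h0 this
      nlinarith [this]
  · rw [halfNeg_of_le hx, halfNeg_of_le hy]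
    have := mul_nonneg (sq_nonneg (v x - v y)) h0
    have := mul_nonneg (sq_nonneg (v x + v y)) h1
    simp only [sub_zero, ne_eq, OfNat.ofNat_ne_zero, not_false_eq_true, zero_pow, zero_mul]
    linarith

/-- The energy inequality for antisymmetric functions. With `ψ` the negative part of `v` on the half
space, `form J v ψ ≤ -form J ψ ψ`, and the interaction with a subset `M` of the half space on which
`v ≥ d` improves the inequality further. -/
lemma form_halfNeg_le (hJ : LevyKernel J) (hv : FiniteEnergy J v) {l : ℝ}
    (hanti : ∀ x, v (refl l x) = -v x) {M : Set (E n)} (hM : MeasurableSet M)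
    (hMl : ∀ y ∈ M, l < y 0) {d κ : ℝ} (hd : 0 ≤ d) (hvM : ∀ y ∈ M, d ≤ v y)
    (hκ : ∀ᵐ x, halfNeg l v x ≠ 0 → κ ≤ ∫ y in M, (J (x - y) - J (x - refl l y)))
    (hint : Integrable (halfNeg l v)) :
    form J v (halfNeg l v) + form J (halfNeg l v) (halfNeg l v)
      + d * κ / 2 * ∫ x, halfNeg l v x ≤ 0 := by
  have hψ := hv.halfNeg hJ hanti
  set ψ := halfNeg l v with hψdef
  have hψ0 : ∀ x, 0 ≤ ψ x := halfNeg_nonneg l v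
  -- `g` is the positive part of `v` on the half space and `v` elsewhere, so `g * ψ = 0`
  let g : E n → ℝ := fun x => v x + ψ x
  have hg_pos {x : E n} (hx : l < x 0) : g x = max (v x) 0 := by
    simp only [g, hψdef, halfNeg_of_lt hx]
    rcases le_total (v x) 0 with h | h
    · rw [max_eq_left (by linarith), max_eq_right h]; ring
    · rw [max_eq_right (by linarith), max_eq_left h]; ring
  have hg_neg {x : E n} (hx : x 0 ≤ l) : g x = v x := by
    simp only [g, hψdef, halfNeg_of_le hx, add_zero]
  have hψ_neg {x : E n} (hx : x 0 ≤ l) : ψ x = 0 := halfNeg_of_le hx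
  have hgψ (x : E n) : g x * ψ x = 0 := by
    by_cases h : ψ x = 0
    · rw [h, mul_zero]
    · have : ψ x = -v x := halfNeg_eq_neg h
      simp [g, this]
  let K : E n × E n → ℝ := fun p => g p.2 * ψ p.1 * J (p.1 - p.2)
  have hFint := (hv.integrable_mul hJ hψ).add (hψ.integrable_mul hJ hψ)
  have hF (p : E n × E n) : (v p.1 - v p.2) * (ψ p.1 - ψ p.2) * J (p.1 - p.2)
      + (ψ p.1 - ψ p.2) * (ψ p.1 - ψ p.2) * J (p.1 - p.2) = -(K p + K p.swap) := by
    simp only [K, Prod.fst_swap, Prod.snd_swap, hJ.sub_comm p.2 p.1]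
    have h1 := hgψ p.1
    have h2 := hgψ p.2
    simp only [g] at h1 h2 ⊢
    linear_combination J (p.1 - p.2) * (h1 + h2)
  have hKm : AEStronglyMeasurable K := by
    have h1 := hv.measurable
    have h2 := hψ.measurable
    exact (((h1.add h2).comp measurable_snd).mul (h2.comp measurable_fst)).aemeasurable.mul
      hJ.aemeasurable_sub |>.aestronglyMeasurable
  have hKint : Integrable K := by
    refine hFint.mono hKm (ae_of_all _ fun p => ?_)
    simp only [Pi.add_apply, hF, norm_neg]
    simp only [Real.norm_eq_abs]
    have h0 := hJ.nonneg (p.1 - p.2)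
    rcases lt_or_ge l (p.1 0) with hx | hx
    · rcases lt_or_ge l (p.2 0) with hy | hy
      · have h1 : 0 ≤ K p := mul_nonneg (mul_nonneg (by rw [hg_pos hy]; simp) (hψ0 _)) h0
        have h2 : 0 ≤ K p.swap := mul_nonneg (mul_nonneg
          (by rw [Prod.snd_swap, hg_pos hx]; simp) (hψ0 _)) (hJ.nonneg _)
        rw [abs_of_nonneg h1, abs_of_nonneg (by positivity)]
        linarith
      · have : K p.swap = 0 := by simp [K, hψ_neg hy]
        rw [this, add_zero]
    · have : K p = 0 := by simp [K, hψ_neg hx]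
      rw [this, abs_zero]
      positivity
  have hKsw : Integrable (fun p : E n × E n => K p.swap) := hKint.swap
  have hswap : ∫ p : E n × E n, K p.swap = ∫ p, K p := integral_prod_swap K
  have hsum : form J v ψ + form J ψ ψ = -∫ p, K p := by
    unfold form
    rw [← mul_add, ← integral_add (hv.integrable_mul hJ hψ) (hψ.integrable_mul hJ hψ)]
    simp only [hF]
    rw [integral_neg, integral_add hKint hKsw, hswap]
    ring
  -- average over the reflection of the second variable
  let S : E n × E n → ℝ := fun p => K p + K (p.1, refl l p.2)
  have hKR : Integrable (fun p : E n × E n => K (p.1, refl l p.2)) :=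
    ((measurePreserving_refl_snd l).integrable_comp_emb (measurableEmbedding_refl_snd l)).2 hKint
  have hS_int : Integrable S := hKint.add hKR
  have hS : ∫ p, S p = 2 * ∫ p, K p := by
    have : ∫ p : E n × E n, K (p.1, refl l p.2) = ∫ p, K p :=
      (measurePreserving_refl_snd l).integral_comp (measurableEmbedding_refl_snd l) K
    rw [integral_add hKint hKR, this]
    ring
  have hS_ge {x y : E n} (hy : l < y 0) :
      max (v y) 0 * ψ x * (J (x - y) - J (x - refl l y)) ≤ S (x, y) := by
    have h1 : refl l y 0 ≤ l := by simp; linarith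
    simp only [S, K, hg_pos hy, hg_neg h1, hanti]
    have h2 := mul_nonneg (mul_nonneg (sub_nonneg.2 (le_max_left (v y) 0)) (hψ0 x))
      (hJ.nonneg (x - refl l y))
    linarith
  have hS_nonneg_pos {x y : E n} (hy : l < y 0) :
      0 ≤ max (v y) 0 * ψ x * (J (x - y) - J (x - refl l y)) := by
    rcases eq_or_ne (max (v y) 0 * ψ x) 0 with h | h
    · rw [h, zero_mul]
    · have hψx : ψ x ≠ 0 := right_ne_zero_of_mul h
      have hx := (halfNeg_ne_zero_iff.1 hψx).1
      have hxy : x ≠ y := by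
        rintro rfl
        rw [← hg_pos hx] at h
        exact h (hgψ x)
      exact mul_nonneg (mul_nonneg (le_max_right _ _) (hψ0 x))
        (sub_nonneg.2 (hJ.sub_refl_le hx.le hy.le hxy))
  have hS_nonneg (x y : E n) : 0 ≤ S (x, y) := by
    rcases lt_trichotomy l (y 0) with hy | hy | hy
    · exact (hS_nonneg_pos hy).trans (hS_ge hy)
    · have hR : refl l y = y := ext_first_rest (by simp; linarith) (by simp)
      have hv0 : v y = 0 := by
        have := hanti y
        rw [hR] at this
        linarith
      simp [S, K, hR, hg_neg hy.ge, hv0]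
    · have hR : l < refl l y 0 := by simp; linarith
      have h := (hS_nonneg_pos hR).trans (hS_ge hR (x := x))
      have hSR : S (x, refl l y) = S (x, y) := by
        simp only [S, refl_refl]
        exact _root_.add_comm _ _
      rwa [hSR] at h
  have hmain : d * κ * ∫ x, ψ x ≤ ∫ p, S p := by
    rw [Measure.volume_eq_prod, integral_prod _ hS_int, ← integral_const_mul]
    refine integral_mono_ae (hint.const_mul _) hS_int.integral_prod_left ?_
    filter_upwards [hκ, hS_int.prod_right_ae] with x hx hSx
    by_cases hψx : ψ x = 0
    · rw [hψx, mul_zero]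
      exact integral_nonneg fun y => hS_nonneg x y
    calc d * κ * ψ x ≤ d * ψ x * ∫ y in M, (J (x - y) - J (x - refl l y)) := by
          rw [mul_right_comm]
          exact mul_le_mul_of_nonneg_left (hx hψx) (mul_nonneg hd (hψ0 x))
      _ = ∫ y, M.indicator (fun y => d * ψ x * (J (x - y) - J (x - refl l y))) y := by
          rw [integral_indicator hM, integral_const_mul]
      _ ≤ ∫ y, S (x, y) := by
          have hxl := (halfNeg_ne_zero_iff.1 hψx)
          have hpos : ∀ y ∈ M, d * ψ x * (J (x - y) - J (x - refl l y)) ≤ S (x, y) ∧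
              0 ≤ d * ψ x * (J (x - y) - J (x - refl l y)) := by
            intro y hy
            have hxy : x ≠ y := by
              rintro rfl
              linarith [hvM x hy]
            have h1 := hJ.sub_refl_le hxl.1.le (hMl y hy).le hxy
            have h2 := sub_nonneg.2 h1
            refine ⟨le_trans ?_ (hS_ge (hMl y hy)),
              mul_nonneg (mul_nonneg hd (hψ0 x)) h2⟩
            gcongr
            · exact hψ0 x
            · exact (hvM y hy).trans (le_max_left _ _)
          refine integral_mono_of_nonneg (ae_of_all _ fun y => ?_) hSx (ae_of_all _ fun y => ?_)
          · exact Set.indicator_nonneg (fun y hy => (hpos y hy).2) y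
          · by_cases hy : y ∈ M
            · rw [Set.indicator_of_mem hy]; exact (hpos y hy).1
            · rw [Set.indicator_of_notMem hy]; exact hS_nonneg x y
  linarith

/-- A one-sided bound on second differences of `θ`, where `ψ` does not vanish, bounds
`form J θ ψ` from above. -/
lemma form_le_of_second_difference_le (hJ : LevyKernel J) {θ ψ : E n → ℝ} (hθ : FiniteEnergy J θ)
    (hψ : FiniteEnergy J ψ) {B C : ℝ} (hB : ∀ x, |θ x| ≤ B) (hψi : Integrable ψ)
    (hψ0 : ∀ x, 0 ≤ ψ x)
    (hC : ∀ᵐ x, ψ x ≠ 0 → ∀ z, 2 * θ x - θ (x + z) - θ (x - z) ≤ C * min 1 (‖z‖ ^ 2)) :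
    form J θ ψ ≤ C / 2 * (∫ z, min 1 (‖z‖ ^ 2) * J z) * ∫ x, ψ x := by
  have hshear : MeasurePreserving (fun p : E n × E n => (p.1, p.1 + p.2)) :=
    measurePreserving_prod_add volume volume
  have hemb : MeasurableEmbedding (fun p : E n × E n => (p.1, p.1 + p.2)) :=
    (MeasurableEquiv.shearAddRight (E n)).measurableEmbedding
  let F : E n × E n → ℝ :=
    fun p => (θ p.1 - θ (p.1 + p.2)) * (ψ p.1 - ψ (p.1 + p.2)) * J p.2
  have hFint : Integrable F := by
    have := (hshear.integrable_comp_emb hemb).2 (hθ.integrable_mul hJ hψ)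
    refine this.congr (ae_of_all _ fun p => ?_)
    simp [F, hJ.even]
  have hform : form J θ ψ = 1 / 2 * ∫ p, F p := by
    unfold form
    rw [← hshear.integral_comp hemb]
    simp [F, hJ.even]
  have hθb (a : E n → E n) (ha : Measurable a) :
      Integrable (fun x => θ (a x) * ψ x) :=
    hψi.bdd_mul (hθ.measurable.comp ha).aestronglyMeasurable (ae_of_all _ fun x => hB (a x))
  have hinner (z : E n) : ∫ x, F (x, z) ≤ C * (min 1 (‖z‖ ^ 2) * J z) * ∫ x, ψ x := by
    have h1 : Integrable (fun x => (θ x - θ (x + z)) * ψ x) := 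
      ((hθb id measurable_id).sub (hθb (· + z) (measurable_add_const z))).congr
        (ae_of_all _ fun x => by simp [sub_mul])
    have h2 : Integrable (fun x => (θ (x - z) - θ x) * ψ x) := 
      ((hθb (· - z) (measurable_sub_const z)).sub (hθb id measurable_id)).congr
        (ae_of_all _ fun x => by simp [sub_mul])
    have h2' : Integrable (fun x => (θ x - θ (x + z)) * ψ (x + z)) := by
      simpa using h2.comp_add_right z
    have h3 : ∫ x, (θ x - θ (x + z)) * ψ (x + z) = ∫ x, (θ (x - z) - θ x) * ψ x := by
      rw [← integral_add_right_eq_self (fun x => (θ (x - z) - θ x) * ψ x) z]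
      simp
    calc ∫ x, F (x, z)
        = J z * ((∫ x, (θ x - θ (x + z)) * ψ x) - ∫ x, (θ x - θ (x + z)) * ψ (x + z)) := by
          rw [← integral_sub h1 h2', ← integral_const_mul]
          refine integral_congr_ae (ae_of_all _ fun x => ?_)
          simp only [F]
          ring
      _ = J z * ∫ x, (2 * θ x - θ (x + z) - θ (x - z)) * ψ x := by
          rw [h3, ← integral_sub h1 h2]
          congr 2 with x
          ring
      _ ≤ J z * ∫ x, C * min 1 (‖z‖ ^ 2) * ψ x := by
          refine mul_le_mul_of_nonneg_left ?_ (hJ.nonneg z)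
          refine integral_mono_ae ?_ (hψi.const_mul _) ?_
          · refine (h1.sub h2).congr (ae_of_all _ fun x => ?_)
            simp only [Pi.sub_apply]
            ring
          · filter_upwards [hC] with x hx
            by_cases h0 : ψ x = 0
            · simp [h0]
            · exact mul_le_mul_of_nonneg_right (hx h0 z) (hψ0 x)
      _ = _ := by
          rw [integral_const_mul]
          ring
  have hle : ∫ p, F p ≤ C * (∫ z, min 1 (‖z‖ ^ 2) * J z) * ∫ x, ψ x := by
    rw [Measure.volume_eq_prod, integral_prod_symm _ hFint]
    calc ∫ z, ∫ x, F (x, z) ≤ ∫ z, C * (min 1 (‖z‖ ^ 2) * J z) * ∫ x, ψ x :=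
          integral_mono hFint.integral_prod_right
            ((hJ.integrable.const_mul C).mul_const _) hinner
      _ = _ := by rw [integral_mul_const, integral_const_mul]
  rw [hform]
  linarith

/-- A bounded Lipschitz function with bounded support has finite energy. -/
lemma finiteEnergy_of_sq_sub_le (hJ : LevyKernel J) {θ : E n → ℝ} (hθ : Measurable θ) {D R : ℝ}
    {x₀ : E n} (hD : ∀ x y, (θ x - θ y) ^ 2 ≤ D * min 1 (‖x - y‖ ^ 2))
    (hR : ∀ x, x ∉ Metric.ball x₀ R → θ x = 0) : FiniteEnergy J θ := by
  refine ⟨hθ, ?_⟩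
  let m : E n → ℝ := fun z => min 1 (‖z‖ ^ 2) * J z
  let χ : E n → ℝ := (Metric.ball x₀ R).indicator fun _ => 1
  have hχ : Integrable χ := (integrable_indicator_iff measurableSet_ball).2
    (integrableOn_const measure_ball_lt_top.ne)
  have hχ0 (x : E n) : 0 ≤ χ x := Set.indicator_nonneg (fun _ _ => zero_le_one) x
  have hχ1 {x : E n} (hx : x ∈ Metric.ball x₀ R) : χ x = 1 := Set.indicator_of_mem hx _
  have h1 : Integrable (fun p : E n × E n => χ p.1 * m (p.1 - p.2)) := by
    have := (measurePreserving_prod_neg_add (volume : Measure (E n))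
      volume).integrable_comp_of_integrable (hχ.mul_prod hJ.integrable)
    refine this.congr (ae_of_all _ fun p => ?_)
    simp only [Function.comp_apply, m]
    rw [← hJ.even (p.1 - p.2), ← norm_neg (p.1 - p.2), neg_sub, neg_add_eq_sub]
  have h2 : Integrable (fun p : E n × E n => χ p.2 * m (p.1 - p.2)) := by
    refine h1.swap.congr (ae_of_all _ fun p => ?_)
    simp only [Function.comp_apply, Prod.fst_swap, Prod.snd_swap, m]
    rw [hJ.sub_comm, norm_sub_rev]
  refine ((h1.add h2).const_mul D).mono' (by
    simpa only [sq] using aestronglyMeasurable_form hJ hθ hθ) (ae_of_all _ fun p => ?_)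
  rw [Real.norm_of_nonneg (sq_diff_mul_nonneg hJ θ p)]
  have hm : (θ p.1 - θ p.2) ^ 2 * J (p.1 - p.2) ≤ D * m (p.1 - p.2) := by
    simp only [m, ← mul_assoc]
    exact mul_le_mul_of_nonneg_right (hD p.1 p.2) (hJ.nonneg _)
  have hm0 : 0 ≤ D * m (p.1 - p.2) := (sq_diff_mul_nonneg hJ θ p).trans hm
  simp only [Pi.add_apply]
  by_cases hx : p.1 ∈ Metric.ball x₀ R
  · rw [hχ1 hx]
    nlinarith [mul_nonneg (hχ0 p.2) hm0]
  · by_cases hy : p.2 ∈ Metric.ball x₀ R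
    · rw [hχ1 hy]
      nlinarith [mul_nonneg (hχ0 p.1) hm0]
    · rw [hR _ hx, hR _ hy]
      nlinarith [mul_nonneg (hχ0 p.1) hm0, mul_nonneg (hχ0 p.2) hm0]

end

/-! ### Reflected solutions and sets of small measure -/

section

variable {n : ℕ} {J : E n → ℝ} {Ω : Set (E n)} {f : E n → ℝ → ℝ} {u : E n → ℝ} {L : ℝ}

/-- The difference `u(2l - x_1, x') - u(x)` of the reflected function and `u`. -/
def reflDiff (l : ℝ) (u : E n → ℝ) (x : E n) : ℝ := u (refl l x) - u x

lemma reflDiff_refl (l : ℝ) (u : E n → ℝ) (x : E n) :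
    reflDiff l u (refl l x) = -reflDiff l u x := by simp [reflDiff]

/-- A solution for a regular kernel, represented by a measurable, nonnegative and bounded function;
`L` is a Lipschitz constant of the nonlinearity on the range of `u`. -/
structure PositiveSolution (J : E n → ℝ) (Ω : Set (E n)) (f : E n → ℝ → ℝ) (u : E n → ℝ)
    (L : ℝ) : Prop where
  kernel : LevyKernel J
  kernel_strict : ∃ r₀ : ℝ, 0 < r₀ ∧ ∀ z y : E n, z ≠ 0 → rest z = rest y → ‖rest z‖ < r₀ →
    |z 0| < |y 0| → |z 0| < r₀ → J y < J z
  domain : SteinerDomain Ω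
  monotone : NonlinearityMonotone Ω f
  solution : IsSolution J Ω f u
  measurable : Measurable u
  nonneg : ∀ x, 0 ≤ u x
  bounded : ∃ C, ∀ x, u x ≤ C
  pos : ∀ᵐ x, x ∈ Ω → 0 < u x
  lipschitz_nonneg : 0 ≤ L
  lipschitz : ∀ x ∈ Ω, ∀ y z, |f x (u y) - f x (u z)| ≤ L * |u y - u z|

lemma SteinerDomain.pt_mem (hΩ : SteinerDomain Ω) {x : E n} (hx : x ∈ Ω) {t : ℝ}
    (ht : |t| ≤ |x 0|) : pt t (rest x) ∈ Ω := by
  rcases eq_or_ne (x 0) 0 with h0 | h0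
  · have : t = x 0 := by rw [h0, abs_zero] at ht; rw [h0]; exact abs_nonpos_iff.1 ht
    rwa [this, pt_rest]
  · have h := hΩ.steiner x hx (t / x 0) (by
      rw [Set.mem_Icc, ← abs_le, abs_div]; exact (div_le_one (abs_pos.2 h0)).2 ht)
    rwa [div_mul_cancel₀ _ h0] at h

lemma SteinerDomain.refl_mem (hΩ : SteinerDomain Ω) {x : E n} (hx : x ∈ Ω) {l : ℝ} (hl : 0 ≤ l)
    (hxl : l < x 0) : refl l x ∈ Ω := by
  refine hΩ.pt_mem hx ?_
  rw [abs_of_pos (hl.trans_lt hxl), abs_le]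
  constructor <;> linarith

lemma NonlinearityMonotone.le_refl (hf : NonlinearityMonotone Ω f) {x : E n} (hx : x ∈ Ω) {l : ℝ}
    (hl : 0 ≤ l) (hxl : l < x 0) (τ : ℝ) : f x τ ≤ f (refl l x) τ := by
  have h0 : 0 < x 0 := hl.trans_lt hxl
  have h := hf τ x hx ((2 * l - x 0) / x 0) (by
    rw [Set.mem_Icc, le_div_iff₀ h0, div_le_iff₀ h0]
    constructor <;> linarith)
  rwa [div_mul_cancel₀ _ h0.ne'] at h

lemma SteinerDomain.integrable_of_bounded (hΩ : SteinerDomain Ω) {g : E n → ℝ} (hg : Measurable g)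
    {B : ℝ} (hB : ∀ x, |g x| ≤ B) (h0 : ∀ x, x ∉ Ω → g x = 0) : Integrable g := by
  have : IntegrableOn g Ω := Measure.integrableOn_of_bounded (M := B)
    hΩ.isBounded.measure_lt_top.ne hg.aestronglyMeasurable (ae_of_all _ hB)
  exact (integrableOn_iff_integrable_of_support_subset
    (fun x hx => by_contra fun h => hx (h0 x h))).1 this

namespace PositiveSolution

lemma eq_zero (h : PositiveSolution J Ω f u L) {x : E n} (hx : x ∉ Ω) : u x = 0 :=
  h.solution.memD.eq_zero x hx

lemma finiteEnergy (h : PositiveSolution J Ω f u L) : FiniteEnergy J u :=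
  (finiteEnergy_iff_energy_lt_top h.kernel h.measurable).2 h.solution.memD.energy_lt_top

lemma finiteEnergy_reflDiff (h : PositiveSolution J Ω f u L) (l : ℝ) :
    FiniteEnergy J (reflDiff l u) :=
  (h.finiteEnergy.comp_refl h.kernel l).sub h.kernel h.finiteEnergy

lemma integrable (h : PositiveSolution J Ω f u L) : Integrable u := by
  obtain ⟨C, hC⟩ := h.bounded
  exact h.domain.integrable_of_bounded h.measurable
    (fun x => by rw [abs_of_nonneg (h.nonneg x)]; exact hC x) fun x hx => h.eq_zero hx

lemma abs_reflDiff_le (h : PositiveSolution J Ω f u L) {C : ℝ} (hC : ∀ x, u x ≤ C) (l : ℝ)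
    (x : E n) : |reflDiff l u x| ≤ C := by
  rw [reflDiff, abs_le]
  constructor <;> linarith [hC x, hC (refl l x), h.nonneg x, h.nonneg (refl l x)]

lemma reflDiff_nonneg_of_notMem (h : PositiveSolution J Ω f u L) {x : E n} (hx : x ∉ Ω) (l : ℝ) :
    0 ≤ reflDiff l u x := by
  rw [reflDiff, h.eq_zero hx, sub_zero]
  exact h.nonneg _

/-- For `l ≥ 0` the function `reflDiff l u` is a supersolution of a linear equation on the part of
`Ω` in the half space `{x_1 > l}`. -/
lemma le_form_reflDiff (h : PositiveSolution J Ω f u L) {l : ℝ} (hl : 0 ≤ l) {ψ : E n → ℝ}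
    (hψ : FiniteEnergy J ψ) (hψ0 : ∀ x, 0 ≤ ψ x) (hψi : Integrable ψ)
    (hψs : ∀ x, ψ x ≠ 0 → x ∈ Ω ∧ l < x 0) :
    -(L * ∫ x, |reflDiff l u x| * ψ x) ≤ form J (reflDiff l u) ψ := by
  have hψR := hψ.comp_refl h.kernel l
  have hψ_zero : ∀ x, x ∉ Ω → ψ x = 0 := fun x hx => by_contra fun h' => hx (hψs x h').1
  have hψR_zero : ∀ x, x ∉ Ω → ψ (refl l x) = 0 := fun x hx => by_contra fun h' => hx (by
    obtain ⟨h1, h2⟩ := hψs _ h'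
    have := h.domain.refl_mem h1 hl h2
    rwa [refl_refl] at this)
  have memD {φ : E n → ℝ} (hφ : FiniteEnergy J φ) (h0 : ∀ x, x ∉ Ω → φ x = 0) : MemD J Ω φ :=
    ⟨hφ.measurable.aemeasurable, (finiteEnergy_iff_energy_lt_top h.kernel hφ.measurable).1 hφ, h0⟩
  have hweak {φ : E n → ℝ} (hφ : FiniteEnergy J φ) (h0 : ∀ x, x ∉ Ω → φ x = 0) :
      Integrable (fun x => f x (u x) * φ x) ∧ form J u φ = ∫ x, f x (u x) * φ x := by
    have hsupp : ∀ x, x ∉ Ω → f x (u x) * φ x = 0 := fun x hx => by rw [h0 x hx, mul_zero]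
    refine ⟨(integrableOn_iff_integrable_of_support_subset
      (fun x hx => by_contra fun h' => hx (hsupp x h'))).1
        (h.solution.integrable φ (memD hφ h0)), ?_⟩
    rw [h.solution.eq φ (memD hφ h0), setIntegral_eq_integral_of_forall_compl_eq_zero hsupp]
  obtain ⟨hi1, he1⟩ := hweak hψ hψ_zero
  obtain ⟨hi2, he2⟩ := hweak hψR hψR_zero
  have hi3 : Integrable (fun x => f (refl l x) (u (refl l x)) * ψ x) := by
    have := ((measurePreserving_refl l).integrable_comp_emb (measurableEmbedding_refl l)).2 hi2
    refine this.congr (ae_of_all _ fun x => ?_)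
    simp
  have he3 : ∫ x, f x (u x) * ψ (refl l x) = ∫ x, f (refl l x) (u (refl l x)) * ψ x := by
    rw [← (measurePreserving_refl l).integral_comp (measurableEmbedding_refl l)]
    simp
  have hform : form J (reflDiff l u) ψ
      = ∫ x, (f (refl l x) (u (refl l x)) * ψ x - f x (u x) * ψ x) := by
    have : reflDiff l u = (fun x => u (refl l x)) - u := rfl
    rw [this, form_sub_left h.kernel (h.finiteEnergy.comp_refl h.kernel l) h.finiteEnergy hψ,
      form_comp_refl h.kernel, he2, he1, he3, integral_sub hi3 hi1]
  obtain ⟨C, hC⟩ := h.bounded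
  have hwψ : Integrable (fun x => |reflDiff l u x| * ψ x) :=
    hψi.bdd_mul (h.finiteEnergy_reflDiff l).measurable.abs.aestronglyMeasurable
      (ae_of_all _ fun x => by rw [Real.norm_eq_abs, abs_abs]; exact h.abs_reflDiff_le hC l x)
  rw [hform, ← integral_const_mul, ← integral_neg]
  refine integral_mono (hwψ.const_mul L).neg (hi3.sub hi1) fun x => ?_
  simp only
  by_cases hx : ψ x = 0
  · simp [hx]
  · obtain ⟨hxΩ, hxl⟩ := hψs x hx
    rw [← sub_mul, ← mul_assoc, ← neg_mul]
    refine mul_le_mul_of_nonneg_right ?_ (hψ0 x)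
    have h1 := h.monotone.le_refl hxΩ hl hxl (u (refl l x))
    have h2 := h.lipschitz x hxΩ (refl l x) x
    rw [reflDiff]
    linarith [neg_abs_le (f x (u (refl l x)) - f x (u x))]

/-- Maximum principle for sets of small measure: `reflDiff l u` is nonnegative on the half space if
the set where it is negative has small measure, uniformly in `l ≥ 0`. -/
lemma exists_reflDiff_nonneg_of_measure_lt (h : PositiveSolution J Ω f u L) :
    ∃ δ : ℝ≥0∞, 0 < δ ∧ ∀ l, 0 ≤ l → volume {x | l < x 0 ∧ reflDiff l u x < 0} < δ →
      ∀ᵐ x, l < x 0 → 0 ≤ reflDiff l u x := by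
  obtain ⟨δ, hδ, hP⟩ := exists_poincare h.kernel (L + 1)
  refine ⟨δ, hδ, fun l hl hsm => ?_⟩
  obtain ⟨C, hC⟩ := h.bounded
  have hw := h.finiteEnergy_reflDiff l
  have hψ := hw.halfNeg h.kernel (reflDiff_refl l u)
  set ψ := halfNeg l (reflDiff l u) with hψdef
  have hψs (x : E n) (hx : ψ x ≠ 0) : x ∈ Ω ∧ l < x 0 := by
    obtain ⟨h1, h2⟩ := halfNeg_ne_zero_iff.1 hx
    exact ⟨by_contra fun h' => h2.not_ge (h.reflDiff_nonneg_of_notMem h' l), h1⟩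
  have hψ_abs (x : E n) (hx : ψ x ≠ 0) : |reflDiff l u x| = ψ x := by
    rw [hψdef, halfNeg_eq_neg hx, abs_of_neg (halfNeg_ne_zero_iff.1 hx).2]
  have hψ_zero : ∀ x, x ∉ Ω → ψ x = 0 := fun x hx => by_contra fun h' => hx (hψs x h').1
  have hψB (x : E n) : |ψ x| ≤ C := by
    by_cases hx : ψ x = 0
    · rw [hx, abs_zero]; exact (h.nonneg x).trans (hC x)
    · rw [← hψ_abs x hx, abs_abs]; exact h.abs_reflDiff_le hC l x
  have hψi : Integrable ψ := h.domain.integrable_of_bounded hψ.measurable hψB hψ_zero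
  have hψi2 : Integrable (fun x => ψ x ^ 2) :=
    h.domain.integrable_of_bounded (B := C ^ 2) (hψ.measurable.pow_const 2)
      (fun x => by rw [abs_pow]; gcongr; exact hψB x) fun x hx => by rw [hψ_zero x hx]; simp
  have h1 := h.le_form_reflDiff hl hψ (halfNeg_nonneg l _) hψi hψs
  have h2 := form_halfNeg_le h.kernel hw (reflDiff_refl l u) (M := ∅) MeasurableSet.empty
    (by simp) (d := 0) (κ := 0) le_rfl (by simp) (ae_of_all _ fun x _ => by simp) hψi
  have h3 := hP ψ hψ (by
    refine (measure_mono fun x hx => ?_).trans_lt hsm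
    exact halfNeg_ne_zero_iff.1 hx) hψi2
  have h4 : ∫ x, |reflDiff l u x| * ψ x = ∫ x, ψ x ^ 2 := by
    congr with x
    by_cases hx : ψ x = 0
    · simp [hx]
    · rw [hψ_abs x hx, sq]
  rw [h4] at h1
  have h5 : ∫ x, ψ x ^ 2 = 0 :=
    le_antisymm (by rw [← hψdef] at h2; linarith) (integral_nonneg fun x => sq_nonneg _)
  have h6 := (integral_eq_zero_iff_of_nonneg (fun x => sq_nonneg (ψ x)) hψi2).1 h5
  filter_upwards [h6] with x hx hxl
  by_contra! hneg
  exact halfNeg_ne_zero_iff.2 ⟨hxl, hneg⟩ (pow_eq_zero_iff two_ne_zero |>.1 hx)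

end PositiveSolution

end

/-! ### Cutoff functions and jump intensities -/

section

variable {n : ℕ} {J : E n → ℝ} {Ω : Set (E n)} {f : E n → ℝ → ℝ} {u : E n → ℝ} {L : ℝ}

/-- The truncated paraboloid `max(0, r² - |x - x₀|²)`, a cutoff function that is Lipschitz and
semiconvex. -/
noncomputable def bump (x₀ : E n) (r : ℝ) (x : E n) : ℝ := max 0 (r ^ 2 - ‖x - x₀‖ ^ 2)

lemma measurable_bump (x₀ : E n) (r : ℝ) : Measurable (bump x₀ r) := by
  unfold bump; fun_prop

lemma bump_nonneg (x₀ : E n) (r : ℝ) (x : E n) : 0 ≤ bump x₀ r x := le_max_left _ _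

lemma bump_le (x₀ : E n) (r : ℝ) (x : E n) : bump x₀ r x ≤ r ^ 2 :=
  max_le (sq_nonneg r) (by linarith [sq_nonneg ‖x - x₀‖])

lemma le_bump (x₀ : E n) (r : ℝ) (x : E n) : r ^ 2 - ‖x - x₀‖ ^ 2 ≤ bump x₀ r x := le_max_right _ _

lemma bump_eq_zero {x₀ : E n} {r : ℝ} (hr : 0 ≤ r) {x : E n} (hx : x ∉ Metric.ball x₀ r) :
    bump x₀ r x = 0 := by
  rw [mem_ball_iff_norm, not_lt] at hx
  exact max_eq_left (sub_nonpos.2 (by gcongr))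

lemma bump_second_difference_le (x₀ : E n) {r : ℝ} (hr0 : 0 ≤ r) (hr : r ≤ 1) (x z : E n) :
    2 * bump x₀ r x - bump x₀ r (x + z) - bump x₀ r (x - z) ≤ 2 * min 1 (‖z‖ ^ 2) := by
  have hr2 : r ^ 2 ≤ 1 := pow_le_one₀ hr0 hr
  have h1 := bump_nonneg x₀ r (x + z)
  have h2 := bump_nonneg x₀ r (x - z)
  rw [mul_min_of_nonneg _ _ zero_le_two, le_min_iff]
  refine ⟨by linarith [bump_le x₀ r x], ?_⟩
  rcases le_total (r ^ 2 - ‖x - x₀‖ ^ 2) 0 with h | h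
  · have : bump x₀ r x = 0 := max_eq_left h
    nlinarith [sq_nonneg ‖z‖]
  · have : bump x₀ r x = r ^ 2 - ‖x - x₀‖ ^ 2 := max_eq_right h
    have h3 := le_bump x₀ r (x + z)
    have h4 := le_bump x₀ r (x - z)
    have h5 := parallelogram_law_with_norm ℝ (x - x₀) z
    rw [show x - x₀ + z = x + z - x₀ by abel, show x - x₀ - z = x - z - x₀ by abel] at h5
    nlinarith

lemma sq_bump_sub_le (x₀ : E n) {r : ℝ} (hr0 : 0 ≤ r) (hr : r ≤ 1) (x y : E n) :
    (bump x₀ r x - bump x₀ r y) ^ 2 ≤ 4 * min 1 (‖x - y‖ ^ 2) := by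
  have hr2 : r ^ 2 ≤ 1 := pow_le_one₀ hr0 hr
  have hlip (x y : E n) : bump x₀ r x - bump x₀ r y ≤ 2 * ‖x - y‖ := by
    rcases le_total (r ^ 2 - ‖x - x₀‖ ^ 2) 0 with h | h
    · have : bump x₀ r x = 0 := max_eq_left h
      linarith [bump_nonneg x₀ r y, norm_nonneg (x - y)]
    · have hx : bump x₀ r x = r ^ 2 - ‖x - x₀‖ ^ 2 := max_eq_right h
      have hxr : ‖x - x₀‖ ≤ r := (abs_le_of_sq_le_sq' (by linarith) hr0).2
      have htri : ‖y - x₀‖ ≤ ‖x - x₀‖ + ‖x - y‖ := by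
        rw [norm_sub_rev x y]
        calc ‖y - x₀‖ = ‖(x - x₀) + (y - x)‖ := by congr 1; abel
          _ ≤ _ := norm_add_le _ _
      have h0 := norm_nonneg (x - x₀)
      have h1 := norm_nonneg (x - y)
      rcases le_total ‖y - x₀‖ r with hy | hy
      · nlinarith [le_bump x₀ r y, norm_nonneg (y - x₀)]
      · nlinarith [bump_nonneg x₀ r y]
  rw [mul_min_of_nonneg _ _ (by norm_num), le_min_iff]
  constructor
  · nlinarith [bump_le x₀ r x, bump_le x₀ r y, bump_nonneg x₀ r x, bump_nonneg x₀ r y]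
  · have h1 := hlip x y
    have h2 := hlip y x
    rw [norm_sub_rev] at h2
    nlinarith

lemma finiteEnergy_bump (hJ : LevyKernel J) (x₀ : E n) {r : ℝ} (hr0 : 0 ≤ r) (hr : r ≤ 1) :
    FiniteEnergy J (bump x₀ r) :=
  finiteEnergy_of_sq_sub_le hJ (measurable_bump x₀ r) (sq_bump_sub_le x₀ hr0 hr)
    fun _ => bump_eq_zero hr0

/-- The points of the half space `{y_1 > l}` that are close to `x` in the sense of the strict
monotonicity of the kernel. -/
def halfBox (l r₀ : ℝ) (x : E n) : Set (E n) :=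
  {y | l < y 0 ∧ ‖rest x - rest y‖ < r₀ ∧ |x 0 - y 0| < r₀}

lemma isOpen_halfBox (l r₀ : ℝ) (x : E n) : IsOpen (halfBox l r₀ x) := by
  have h1 := continuous_first (n := n)
  have h2 := continuous_rest (n := n)
  exact (isOpen_lt continuous_const h1).inter ((isOpen_lt (continuous_const.sub h2).norm
    continuous_const).inter (isOpen_lt (continuous_const.sub h1).abs continuous_const))

lemma norm_sub_le_norm_sub_refl {l : ℝ} {x y : E n} (hx : l ≤ x 0) (hy : l ≤ y 0) :
    ‖x - y‖ ≤ ‖x - refl l y‖ := by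
  refine (abs_le_of_sq_le_sq' ?_ (norm_nonneg _)).2
  rw [norm_sq_eq_first_add_rest, norm_sq_eq_first_add_rest (x - refl l y)]
  simp only [PiLp.sub_apply, refl_first, rest_sub, rest_refl]
  nlinarith [mul_nonneg (sub_nonneg.2 hx) (sub_nonneg.2 hy)]

/-- The difference of the jump intensities from `x` into a set `M` and into its reflection is
bounded below near a point `x₀` at positive distance from `M`. -/
lemma exists_forall_le_setIntegral_sub (hJ : LevyKernel J) {r₀ : ℝ}
    (hstrict : ∀ z y : E n, z ≠ 0 → rest z = rest y → ‖rest z‖ < r₀ →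
      |z 0| < |y 0| → |z 0| < r₀ → J y < J z)
    {l ρ : ℝ} (hρ : 0 < ρ) {x₀ : E n} (hx₀ : l < x₀ 0) {M : Set (E n)} (hM : MeasurableSet M)
    (hMbox : M ⊆ halfBox l r₀ x₀) (hMρ : ∀ y ∈ M, ρ ≤ ‖y - x₀‖) (hM0 : volume M ≠ 0) :
    ∃ κ : ℝ, 0 < κ ∧ ∀ᶠ x in 𝓝 x₀, κ ≤ ∫ y in M, (J (x - y) - J (x - refl l y)) := by
  -- truncating the kernel near the origin makes it integrable
  let k : E n → ℝ := {z : E n | ρ / 2 ≤ ‖z‖}.indicator J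
  have hk : Integrable k := hJ.integrable_far (half_pos hρ)
  have hmp1 (x : E n) : MeasurePreserving (fun y : E n => x - y) :=
    Measure.measurePreserving_sub_left volume x
  have hmp2 (x : E n) : MeasurePreserving (fun y : E n => x - refl l y) :=
    (hmp1 x).comp (measurePreserving_refl l)
  have hi1 (x : E n) : Integrable (fun y => k (x - y)) := (hmp1 x).integrable_comp_of_integrable hk
  have hi2 (x : E n) : Integrable (fun y => k (x - refl l y)) :=
    (hmp2 x).integrable_comp_of_integrable hk
  have hc1 : Continuous (fun p : E n × E n => p.1 - p.2) := by fun_prop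
  have hc2 : Continuous (fun p : E n × E n => p.1 - refl l p.2) :=
    continuous_fst.sub ((continuous_refl l).comp continuous_snd)
  have ht1 := tendsto_setIntegral_of_L1 (fun y => k (x₀ - y)) (hi1 x₀).1
    (Eventually.of_forall hi1) (tendsto_lintegral_comp_sub hc1 hmp1 hk x₀) M
  have ht2 := tendsto_setIntegral_of_L1 (fun y => k (x₀ - refl l y)) (hi2 x₀).1
    (Eventually.of_forall hi2) (tendsto_lintegral_comp_sub hc2 hmp2 hk x₀) M
  have ht := ht1.sub ht2
  have hkJ {x : E n} (hx : ‖x - x₀‖ < ρ / 2) (hxl : l < x 0) {y : E n} (hy : y ∈ M) :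
      k (x - y) - k (x - refl l y) = J (x - y) - J (x - refl l y) := by
    have h1 : ρ / 2 ≤ ‖x - y‖ := by
      have := norm_sub_le_norm_sub_add_norm_sub y x x₀
      rw [norm_sub_rev y x] at this
      linarith [hMρ y hy]
    have h2 := h1.trans (norm_sub_le_norm_sub_refl hxl.le (hMbox hy).1.le)
    simp only [k, Set.indicator_of_mem (show x - y ∈ {z : E n | ρ / 2 ≤ ‖z‖} from h1),
      Set.indicator_of_mem (show x - refl l y ∈ {z : E n | ρ / 2 ≤ ‖z‖} from h2)]
  have heq {x : E n} (hx : ‖x - x₀‖ < ρ / 2) (hxl : l < x 0) :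
      (∫ y in M, k (x - y)) - ∫ y in M, k (x - refl l y)
        = ∫ y in M, (J (x - y) - J (x - refl l y)) := by
    rw [← integral_sub (hi1 x).integrableOn (hi2 x).integrableOn]
    exact setIntegral_congr_fun hM fun y hy => hkJ hx hxl hy
  have hpos : 0 < (∫ y in M, k (x₀ - y)) - ∫ y in M, k (x₀ - refl l y) := by
    have hlt (y : E n) (hy : y ∈ M) : 0 < k (x₀ - y) - k (x₀ - refl l y) := by
      rw [hkJ (by simpa using half_pos hρ) hx₀ hy, sub_pos]
      obtain ⟨h1, h2, h3⟩ := hMbox hy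
      refine hstrict _ _ (sub_ne_zero.2 ?_) (by simp) (by simpa using h2) ?_ (by simpa using h3)
      · rintro rfl
        have := hMρ _ hy
        simp only [sub_self, norm_zero] at this
        linarith
      · simp only [PiLp.sub_apply, refl_first]
        rw [abs_lt, abs_of_pos (by linarith : 0 < x₀ 0 - (2 * l - y 0))]
        constructor <;> linarith
    rw [← integral_sub (hi1 x₀).integrableOn (hi2 x₀).integrableOn,
      setIntegral_pos_iff_support_of_nonneg_ae
        (ae_restrict_of_forall_mem hM fun y hy => (hlt y hy).le)
        ((hi1 x₀).sub (hi2 x₀)).integrableOn]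
    refine (pos_iff_ne_zero.2 hM0).trans_le (measure_mono fun y hy => ⟨(hlt y hy).ne', hy⟩)
  refine ⟨_, half_pos hpos, ?_⟩
  have hball : ∀ᶠ x in 𝓝 x₀, ‖x - x₀‖ < ρ / 2 := by
    filter_upwards [Metric.ball_mem_nhds x₀ (half_pos hρ)] with x hx
    rwa [mem_ball_iff_norm] at hx
  have hhalf : ∀ᶠ x in 𝓝 x₀, l < x 0 :=
    (isOpen_lt continuous_const continuous_first).mem_nhds hx₀
  filter_upwards [ht.eventually (lt_mem_nhds (half_lt_self hpos)), hball, hhalf] with x h1 h2 h3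
  rw [← heq h2 h3]
  exact h1.le

end

/-! ### The strong maximum principle -/

section

variable {n : ℕ} {J : E n → ℝ} {Ω : Set (E n)} {f : E n → ℝ → ℝ} {u : E n → ℝ} {L : ℝ}

namespace PositiveSolution

/-- Local form of the strong maximum principle: `reflDiff l u`, if nonnegative on the half space,
either vanishes a.e. on `halfBox l r₀ x₀` or is bounded below by a positive constant near `x₀`. -/
lemma exists_le_reflDiff_of_not_ae_eq_zero (h : PositiveSolution J Ω f u L) {r₀ : ℝ}
    (hstrict : ∀ z y : E n, z ≠ 0 → rest z = rest y → ‖rest z‖ < r₀ →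
      |z 0| < |y 0| → |z 0| < r₀ → J y < J z)
    {l : ℝ} (hl : 0 ≤ l) (hw : ∀ᵐ x, l < x 0 → 0 ≤ reflDiff l u x) {x₀ : E n} (hx₀ : x₀ ∈ Ω)
    (hx₀l : l < x₀ 0) (hbox : ¬ ∀ᵐ y, y ∈ halfBox l r₀ x₀ → reflDiff l u y = 0) :
    ∃ r ε : ℝ, 0 < r ∧ 0 < ε ∧ ∀ᵐ x, x ∈ Metric.ball x₀ r → ε ≤ reflDiff l u x := by
  have hwE := h.finiteEnergy_reflDiff l
  have hwm := hwE.measurable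
  obtain ⟨C, hC⟩ := h.bounded
  have hC0 : 0 ≤ C := (h.nonneg 0).trans (hC 0)
  -- a set `M` of positive measure on which `reflDiff l u` is bounded below
  let M : ℕ → Set (E n) := fun k =>
    {y | y ∈ halfBox l r₀ x₀ ∧ 1 / ((k : ℝ) + 1) ≤ reflDiff l u y ∧ 1 / ((k : ℝ) + 1) ≤ ‖y - x₀‖}
  have hMm (k : ℕ) : MeasurableSet (M k) :=
    (isOpen_halfBox l r₀ x₀).measurableSet.inter ((measurableSet_le measurable_const hwm).inter
      (measurableSet_le measurable_const (measurable_id.sub_const x₀).norm))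
  obtain ⟨k, hk⟩ : ∃ k, volume (M k) ≠ 0 := by
    by_contra! hall
    refine hbox ?_
    have h1 : ∀ᵐ y, ∀ k, y ∉ M k := ae_all_iff.2 fun k => measure_eq_zero_iff_ae_notMem.1 (hall k)
    have h2 : ∀ᵐ y : E n, y ≠ x₀ := Measure.ae_ne volume x₀
    filter_upwards [h1, h2, hw] with y hy1 hy2 hy3 hy
    by_contra hne
    have hpos : 0 < min (reflDiff l u y) ‖y - x₀‖ :=
      lt_min (lt_of_le_of_ne (hy3 hy.1) (Ne.symm hne)) (norm_pos_iff.2 (sub_ne_zero.2 hy2))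
    obtain ⟨k, hk⟩ := exists_nat_one_div_lt hpos
    exact hy1 k ⟨hy, (hk.trans_le (min_le_left _ _)).le, (hk.trans_le (min_le_right _ _)).le⟩
  set d : ℝ := 1 / ((k : ℝ) + 1) with hd
  have hd0 : 0 < d := by positivity
  obtain ⟨κ, hκ0, hκ⟩ := exists_forall_le_setIntegral_sub h.kernel hstrict hd0 hx₀l (hMm k)
    (fun y hy => hy.1) (fun y hy => hy.2.2) hk
  obtain ⟨δ, hδ, hP⟩ := exists_poincare h.kernel 1
  obtain ⟨V, hxV, hVo, hV⟩ := Set.exists_isOpen_lt_of_lt {x₀} δ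
    (by simpa using hδ : (volume : Measure (E n)) {x₀} < δ)
  let s : ℝ := (x₀ 0 - l) / 2
  have hs : 0 < s := half_pos (sub_pos.2 hx₀l)
  have hnear : ∀ᶠ x in 𝓝 x₀, (κ ≤ ∫ y in M k, (J (x - y) - J (x - refl l y))) ∧ x ∈ V ∧ x ∈ Ω ∧
      l + s < x 0 ∧ x ∈ Metric.ball x₀ d := by
    have hsl : l + s < x₀ 0 := by simp only [s]; linarith
    filter_upwards [hκ, hVo.mem_nhds (hxV rfl), h.domain.isOpen.mem_nhds hx₀,
      (isOpen_lt continuous_const continuous_first).mem_nhds hsl,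
      Metric.ball_mem_nhds x₀ hd0] with x h1 h2 h3 h4 h5 using ⟨h1, h2, h3, h4, h5⟩
  obtain ⟨r', hr', hball'⟩ := Metric.eventually_nhds_iff_ball.1 hnear
  -- the ball on which the comparison function is supported
  let r : ℝ := min r' 1
  have hr : 0 < r := lt_min hr' one_pos
  have hr1 : r ≤ 1 := min_le_right _ _
  have hball := fun (x : E n) (hx : x ∈ Metric.ball x₀ r) =>
    hball' x (Metric.ball_subset_ball (min_le_left _ _) hx)
  let η : E n → ℝ := bump x₀ r
  let θ : E n → ℝ := fun x => η x - η (refl l x)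
  have hηE : FiniteEnergy J η := finiteEnergy_bump h.kernel x₀ hr.le hr1
  have hθE : FiniteEnergy J θ := hηE.sub h.kernel (hηE.comp_refl h.kernel l)
  have hη1 (x : E n) : η x ≤ 1 := (bump_le x₀ r x).trans (pow_le_one₀ hr.le hr1)
  have hη_refl {x : E n} (hx : l - s < x 0) : η (refl l x) = 0 :=
    bump_eq_zero hr.le fun hmem => by
      have := (hball _ hmem).2.2.2.1
      simp only [refl_first] at this
      linarith
  have hθ_abs (x : E n) : |θ x| ≤ 1 := by
    rw [abs_le]
    constructor <;> linarith [hη1 x, hη1 (refl l x), bump_nonneg x₀ r x,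
      bump_nonneg x₀ r (refl l x)]
  let m : ℝ := min 1 (s ^ 2)
  have hm : 0 < m := lt_min one_pos (by positivity)
  let A : ℝ := 2 + 2 / m
  have hA : 0 ≤ A := by positivity
  have hsecond (x : E n) (hx : x ∈ Metric.ball x₀ r) (z : E n) :
      2 * θ x - θ (x + z) - θ (x - z) ≤ A * min 1 (‖z‖ ^ 2) := by
    have hxl := (hball x hx).2.2.2.1
    have h1 := bump_second_difference_le x₀ hr.le hr1 x z
    have h2 : η (refl l x) = 0 := hη_refl (by linarith)
    have h3 : η (refl l (x + z)) + η (refl l (x - z)) ≤ 2 / m * min 1 (‖z‖ ^ 2) := by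
      rcases lt_or_ge ‖z‖ s with hz | hz
      · have hz0 := abs_le.1 ((abs_first_le z).trans hz.le)
        rw [hη_refl (by simp only [PiLp.add_apply]; linarith),
          hη_refl (by simp only [PiLp.sub_apply]; linarith), add_zero]
        positivity
      · have : m ≤ min 1 (‖z‖ ^ 2) := min_le_min le_rfl (by gcongr)
        calc _ ≤ (2 : ℝ) := by linarith [hη1 (refl l (x + z)), hη1 (refl l (x - z))]
          _ = 2 / m * m := by field_simp
          _ ≤ _ := by gcongr
    simp only [θ, A, h2]
    simp only [η] at h3 ⊢
    linarith
  let I : ℝ := A / 2 * ∫ z, min 1 (‖z‖ ^ 2) * J z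
  have hI : 0 ≤ I := mul_nonneg (by positivity)
    (integral_nonneg fun z => h.kernel.min_sq_mul_nonneg z)
  have hL := h.lipschitz_nonneg
  -- `ε` is so small that the jumps into `M` dominate both the operator applied to `ε * θ` and the
  -- zeroth order term
  let ε : ℝ := d * κ / 2 / (L + I + 1)
  have hε : 0 < ε := by positivity
  have hεle : ε * (L + I) ≤ d * κ / 2 := by
    have : ε * (L + I + 1) = d * κ / 2 := div_mul_cancel₀ _ (by positivity)
    linarith
  have hεθ : FiniteEnergy J (fun x => ε * θ x) := hθE.const_mul ε
  let v : E n → ℝ := reflDiff l u - fun x => ε * θ x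
  have hvE : FiniteEnergy J v := hwE.sub h.kernel hεθ
  have hv (x : E n) : v x = reflDiff l u x - ε * θ x := rfl
  have hanti (x : E n) : v (refl l x) = -v x := by
    simp only [hv, reflDiff_refl, θ, refl_refl]
    ring
  have hψE := hvE.halfNeg h.kernel hanti
  set ψ := halfNeg l v with hψdef
  have hψ0 : ∀ x, 0 ≤ ψ x := halfNeg_nonneg l v
  have hθ_half {x : E n} (hx : l < x 0) : θ x = η x := by
    simp only [θ, hη_refl (by linarith : l - s < x 0), sub_zero]
  have hθ_half0 {x : E n} (hx : l < x 0) (hxb : x ∉ Metric.ball x₀ r) : θ x = 0 := by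
    rw [hθ_half hx]
    exact bump_eq_zero hr.le hxb
  have hψs (x : E n) (hx : ψ x ≠ 0) : x ∈ Ω ∧ l < x 0 := by
    obtain ⟨h1, h2⟩ := halfNeg_ne_zero_iff.1 hx
    refine ⟨by_contra fun h' => h2.not_ge ?_, h1⟩
    rw [hv, hθ_half0 h1 fun hb => h' (hball x hb).2.2.1, mul_zero, sub_zero]
    exact h.reflDiff_nonneg_of_notMem h' l
  have hψB (x : E n) : |ψ x| ≤ C + ε := by
    by_cases hx : ψ x = 0
    · rw [hx, abs_zero]; positivity
    · rw [hψdef, halfNeg_eq_neg hx, abs_neg, hv]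
      refine (abs_sub _ _).trans (add_le_add (h.abs_reflDiff_le hC l x) ?_)
      rw [abs_mul, abs_of_pos hε]
      exact mul_le_of_le_one_right hε.le (hθ_abs x)
  have hψ_zero : ∀ x, x ∉ Ω → ψ x = 0 := fun x hx => by_contra fun h' => hx (hψs x h').1
  have hψi : Integrable ψ := h.domain.integrable_of_bounded hψE.measurable hψB hψ_zero
  have hψi2 : Integrable (fun x => ψ x ^ 2) :=
    h.domain.integrable_of_bounded (B := (C + ε) ^ 2) (hψE.measurable.pow_const 2)
      (fun x => by rw [abs_pow]; gcongr; exact hψB x) fun x hx => by rw [hψ_zero x hx]; simp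
  have hψball : ∀ᵐ x, ψ x ≠ 0 → x ∈ Metric.ball x₀ r ∧ |reflDiff l u x| ≤ ε := by
    filter_upwards [hw] with x hx hψx
    obtain ⟨h1, h2⟩ := halfNeg_ne_zero_iff.1 hψx
    have h3 := hx h1
    refine ⟨by_contra fun hb => ?_, ?_⟩
    · rw [hv, hθ_half0 h1 hb] at h2
      linarith
    · rw [abs_of_nonneg h3]
      rw [hv] at h2
      have := mul_le_of_le_one_right hε.le ((le_abs_self _).trans (hθ_abs x))
      linarith
  have h1 := h.le_form_reflDiff hl hψE hψ0 hψi hψs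
  have h2 : ∫ x, |reflDiff l u x| * ψ x ≤ ε * ∫ x, ψ x := by
    rw [← integral_const_mul]
    refine integral_mono_of_nonneg
      (ae_of_all _ fun x => mul_nonneg (abs_nonneg _) (hψ0 x)) (hψi.const_mul ε) ?_
    filter_upwards [hψball] with x hx
    by_cases hx0 : ψ x = 0
    · simp [hx0]
    · exact mul_le_mul_of_nonneg_right (hx hx0).2 (hψ0 x)
  have h3 : form J θ ψ ≤ I * ∫ x, ψ x := by
    refine form_le_of_second_difference_le h.kernel hθE hψE hθ_abs hψi hψ0 ?_
    filter_upwards [hψball] with x hx hx0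
    exact hsecond x (hx hx0).1
  have h4 : form J v ψ = form J (reflDiff l u) ψ - ε * form J θ ψ := by
    rw [← form_const_mul_left, ← form_sub_left h.kernel hwE hεθ hψE]
  have h5 := form_halfNeg_le h.kernel hvE hanti (hMm k) (fun y hy => hy.1.1) (d := d) (κ := κ)
    hd0.le (fun y hy => by
      rw [hv, hθ_half0 hy.1.1 fun hb => ?_, mul_zero, sub_zero]
      · exact hy.2.1
      · have := (hball y hb).2.2.2.2
        rw [mem_ball_iff_norm] at this
        exact this.not_ge hy.2.2)
    (by
      filter_upwards [hψball] with x hx hx0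
      exact (hball x (hx hx0).1).1) hψi
  rw [← hψdef] at h5
  have h6 : volume {x | ψ x ≠ 0} < δ := by
    refine lt_of_le_of_lt (measure_mono_ae ?_) hV
    filter_upwards [hψball] with x hx hx0
    exact (hball x (hx hx0).1).2.1
  have h7 := hP ψ hψE h6 hψi2
  have hψint : 0 ≤ ∫ x, ψ x := integral_nonneg hψ0
  have h8 : ∫ x, ψ x ^ 2 = 0 := by
    refine le_antisymm ?_ (integral_nonneg fun x => sq_nonneg _)
    have h9 := mul_le_mul_of_nonneg_right hεle hψint
    have h10 := mul_le_mul_of_nonneg_left h2 hL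
    have h11 := mul_le_mul_of_nonneg_left h3 hε.le
    nlinarith
  have h9 := (integral_eq_zero_iff_of_nonneg (fun x => sq_nonneg (ψ x)) hψi2).1 h8
  refine ⟨r / 2, ε * (3 / 4 * r ^ 2), by positivity, by positivity, ?_⟩
  filter_upwards [h9] with x hx hxb
  have hxr : x ∈ Metric.ball x₀ r := Metric.ball_subset_ball (by linarith) hxb
  have hxl : l < x 0 := by linarith [(hball x hxr).2.2.2.1]
  have hvx : 0 ≤ v x := by
    by_contra! hneg
    exact halfNeg_ne_zero_iff.2 ⟨hxl, hneg⟩ (pow_eq_zero_iff two_ne_zero |>.1 hx)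
  rw [hv, hθ_half hxl] at hvx
  have hηx : 3 / 4 * r ^ 2 ≤ η x := by
    refine le_trans ?_ (le_bump x₀ r x)
    rw [mem_ball_iff_norm] at hxb
    nlinarith [norm_nonneg (x - x₀)]
  linarith [mul_le_mul_of_nonneg_left hηx hε.le]

/-- Strong maximum principle for `l > 0`. If `reflDiff l u` vanished near some point of `Ω` in the
half space, it would also vanish near points outside of `Ω` whose reflection is in `Ω`, where it
agrees with the reflection of `u` and so is positive. -/
lemma exists_le_reflDiff (h : PositiveSolution J Ω f u L) {l : ℝ} (hl : 0 < l)
    (hw : ∀ᵐ x, l < x 0 → 0 ≤ reflDiff l u x) {x₀ : E n} (hx₀ : x₀ ∈ Ω) (hx₀l : l < x₀ 0) :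
    ∃ r ε : ℝ, 0 < r ∧ 0 < ε ∧ ∀ᵐ x, x ∈ Metric.ball x₀ r → ε ≤ reflDiff l u x := by
  obtain ⟨r₀, hr₀, hstrict⟩ := h.kernel_strict
  by_contra hcon
  let S : Set (E n) :=
    {x | x ∈ Ω ∧ l < x 0 ∧ ∀ᵐ y, y ∈ halfBox l r₀ x → reflDiff l u y = 0}
  have hS₀ : x₀ ∈ S := ⟨hx₀, hx₀l, by_contra fun hbox =>
    hcon (h.exists_le_reflDiff_of_not_ae_eq_zero hstrict hl.le hw hx₀ hx₀l hbox)⟩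
  -- an open subset of the half space on which `reflDiff l u` is a.e. zero and positive is empty
  have hopen {W : Set (E n)} (hW : IsOpen W) {P : E n → Prop} (h1 : ∀ᵐ y, y ∈ W → P y)
      (h2 : ∀ᵐ y, y ∈ W → ¬ P y) : W = ∅ := by
    by_contra hne
    refine (hW.measure_pos volume (Set.nonempty_iff_ne_empty.2 hne)).ne' ?_
    rw [measure_eq_zero_iff_ae_notMem]
    filter_upwards [h1, h2] with y hy1 hy2 hy
    exact hy2 hy (hy1 hy)
  have hstep {x y : E n} (hx : x ∈ S) (hy : y ∈ Ω) (hyx : y ∈ halfBox l r₀ x) : y ∈ S := by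
    refine ⟨hy, hyx.1, by_contra fun hbox => ?_⟩
    obtain ⟨r, ε, hr, hε, hle⟩ :=
      h.exists_le_reflDiff_of_not_ae_eq_zero hstrict hl.le hw hy hyx.1 hbox
    have := hopen ((isOpen_halfBox l r₀ x).inter (Metric.isOpen_ball (x := y) (ε := r)))
      (P := fun y => reflDiff l u y = 0) (hx.2.2.mono fun y hy hyW => hy hyW.1)
      (hle.mono fun y hy hyW => (hε.trans_le (hy hyW.2)).ne')
    exact (Set.eq_empty_iff_forall_notMem.1 this y) ⟨hyx, Metric.mem_ball_self hr⟩
  let F : Set ℝ := (fun x : E n => x 0) '' S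
  have hF : BddAbove F := by
    obtain ⟨R, hR⟩ := h.domain.isBounded.exists_norm_le
    refine ⟨R, ?_⟩
    rintro _ ⟨x, hx, rfl⟩
    exact (le_abs_self _).trans ((abs_first_le x).trans (hR x hx.1))
  let a : ℝ := sSup F
  have hpos : 0 < min (r₀ / 2) l := lt_min (half_pos hr₀) hl
  have hFne : F.Nonempty := ⟨x₀ 0, x₀, hS₀, rfl⟩
  obtain ⟨_, ⟨x, hx, rfl⟩, hxa⟩ := exists_lt_of_lt_csSup hFne (sub_lt_self a hpos)
  simp only at hxa
  have hxa' : x 0 ≤ a := le_csSup hF ⟨x, hx, rfl⟩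
  have hxl : l < x 0 := hx.2.1
  have hxa1 : a - r₀ / 2 < x 0 := lt_of_le_of_lt (by linarith [min_le_left (r₀ / 2) l]) hxa
  have hxa2 : a - l < x 0 := lt_of_le_of_lt (by linarith [min_le_right (r₀ / 2) l]) hxa
  obtain ⟨t, hta, ht⟩ : ∃ t, a < t ∧ t < min (a + r₀ / 2) (x 0 + 2 * l) :=
    exists_between (lt_min (by linarith) (by linarith))
  obtain ⟨ht1, ht2⟩ := lt_min_iff.1 ht
  let W : Set (E n) := halfBox l r₀ x ∩ {y | a < y 0} ∩ refl l ⁻¹' Ω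
  have hWo : IsOpen W := ((isOpen_halfBox l r₀ x).inter
    (isOpen_lt continuous_const continuous_first)).inter
      (h.domain.isOpen.preimage (continuous_refl l))
  have hWne : pt t (rest x) ∈ W := by
    refine ⟨⟨⟨?_, ?_, ?_⟩, ?_⟩, ?_⟩
    · rw [pt_zero]; linarith
    · simpa using hr₀
    · rw [pt_zero, abs_lt]; constructor <;> linarith
    · simpa using hta
    · have : refl l (pt t (rest x)) = pt (2 * l - t) (rest x) := by simp [refl]
      rw [Set.mem_preimage, this]
      refine h.domain.pt_mem hx.1 ?_
      rw [abs_of_pos (hl.trans hxl), abs_le]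
      constructor <;> linarith
  have hzero : ∀ᵐ y, y ∈ W → reflDiff l u y = 0 := hx.2.2.mono fun y hy hyW => hy hyW.1.1
  have hnonzero : ∀ᵐ y, y ∈ W → ¬ reflDiff l u y = 0 := by
    filter_upwards [(measurePreserving_refl l).quasiMeasurePreserving.ae h.pos] with y hy hyW
    have hyΩ : y ∉ Ω := fun hyΩ =>
      (le_csSup hF ⟨y, hstep hx hyΩ hyW.1.1, rfl⟩ : y 0 ≤ a).not_gt hyW.1.2
    rw [reflDiff, h.eq_zero hyΩ, sub_zero]
    exact (hy hyW.2).ne'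
  exact (Set.eq_empty_iff_forall_notMem.1 (hopen hWo hzero hnonzero) _) hWne

end PositiveSolution

end

/-! ### Moving planes -/

section

variable {n : ℕ} {J : E n → ℝ} {Ω : Set (E n)} {f : E n → ℝ → ℝ} {u : E n → ℝ} {L : ℝ}

namespace PositiveSolution

lemma exists_subseq_tendsto_reflDiff (h : PositiveSolution J Ω f u L) {l : ℕ → ℝ} {l₀ : ℝ}
    (hl : Tendsto l atTop (𝓝 l₀)) : ∃ φ : ℕ → ℕ, StrictMono φ ∧
      ∀ᵐ x, Tendsto (fun k => reflDiff (l (φ k)) u x) atTop (𝓝 (reflDiff l₀ u x)) := by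
  have hL1 := (tendsto_lintegral_comp_sub continuous_uncurry_refl measurePreserving_refl
    h.integrable l₀).comp hl
  have hmeas (a : ℝ) : AEStronglyMeasurable (fun x => u (refl a x)) :=
    (h.measurable.comp (measurable_refl a)).aestronglyMeasurable
  have hm : TendstoInMeasure volume (fun k x => u (refl (l k) x)) atTop
      (fun x => u (refl l₀ x)) := by
    refine tendstoInMeasure_of_tendsto_eLpNorm one_ne_zero (fun k => hmeas (l k)) (hmeas l₀) ?_
    simp only [eLpNorm_one_eq_lintegral_enorm]
    exact hL1
  obtain ⟨φ, hφ, hlim⟩ := hm.exists_seq_tendsto_ae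
  exact ⟨φ, hφ, hlim.mono fun x hx => hx.sub_const (u x)⟩

lemma reflDiff_nonneg_of_mem_closure (h : PositiveSolution J Ω f u L) {l₀ : ℝ}
    (hl : l₀ ∈ closure {l : ℝ | 0 < l ∧ ∀ᵐ x, l < x 0 → 0 ≤ reflDiff l u x}) :
    ∀ᵐ x, l₀ < x 0 → 0 ≤ reflDiff l₀ u x := by
  obtain ⟨l, hlP, hl⟩ := mem_closure_iff_seq_limit.1 hl
  obtain ⟨φ, hφ, hlim⟩ := h.exists_subseq_tendsto_reflDiff hl
  filter_upwards [hlim, ae_all_iff.2 fun k => (hlP k).2] with x hx hnn hxl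
  refine ge_of_tendsto hx ?_
  filter_upwards [(hl.comp hφ.tendsto_atTop).eventually (gt_mem_nhds hxl)] with k hk
  exact hnn _ hk

lemma reflDiff_pos (h : PositiveSolution J Ω f u L) {l : ℝ} (hl : 0 < l)
    (hw : ∀ᵐ x, l < x 0 → 0 ≤ reflDiff l u x) : ∀ᵐ x, x ∈ Ω → l < x 0 → 0 < reflDiff l u x := by
  have : volume {x | x ∈ Ω ∧ l < x 0 ∧ ¬ 0 < reflDiff l u x} = 0 := by
    refine measure_null_of_locally_null _ fun x hx => ?_
    obtain ⟨r, ε, hr, hε, hle⟩ := h.exists_le_reflDiff hl hw hx.1 hx.2.1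
    refine ⟨Metric.ball x r ∩ {x | x ∈ Ω ∧ l < x 0 ∧ ¬ 0 < reflDiff l u x},
      inter_mem (mem_nhdsWithin_of_mem_nhds (Metric.ball_mem_nhds x hr)) self_mem_nhdsWithin, ?_⟩
    rw [measure_eq_zero_iff_ae_notMem]
    filter_upwards [hle] with y hy hyx
    exact hyx.2.2.2 (hε.trans_le (hy hyx.1))
  filter_upwards [measure_eq_zero_iff_ae_notMem.1 this] with x hx h1 h2
  by_contra h3
  exact hx ⟨h1, h2, h3⟩

/-- Positions of the hyperplane that are admissible in the method of moving planes form an open set: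
strict positivity of `reflDiff l u` makes the set where nearby reflections fail small, so that the
maximum principle for sets of small measure applies. -/
lemma isOpen_setOf_reflDiff_nonneg (h : PositiveSolution J Ω f u L) :
    IsOpen {l : ℝ | 0 < l ∧ ∀ᵐ x, l < x 0 → 0 ≤ reflDiff l u x} := by
  obtain ⟨δ, hδ, hsmall⟩ := h.exists_reflDiff_nonneg_of_measure_lt
  rw [isOpen_iff_mem_nhds]
  rintro l₀ ⟨hl₀, hw⟩
  by_contra hcon
  obtain ⟨l, hl, hbad⟩ := exists_seq_forall_of_frequently (l := 𝓝 l₀)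
    (p := fun l => 0 < l ∧ ¬ ∀ᵐ x, l < x 0 → 0 ≤ reflDiff l u x) (by
      intro hev
      refine hcon ?_
      filter_upwards [hev, lt_mem_nhds hl₀] with l h1 h2
      exact ⟨h2, not_not.1 fun h3 => h1 ⟨h2, h3⟩⟩)
  obtain ⟨φ, hφ, hlim⟩ := h.exists_subseq_tendsto_reflDiff hl
  have hlφ := hl.comp hφ.tendsto_atTop
  let B : ℕ → Set (E n) := fun k => {x | l (φ k) < x 0 ∧ reflDiff (l (φ k)) u x < 0}
  have hB (k : ℕ) : MeasurableSet (B k) :=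
    (measurableSet_lt measurable_const continuous_first.measurable).inter
      (measurableSet_lt (h.finiteEnergy_reflDiff _).measurable measurable_const)
  have hlimB : Tendsto (fun k => volume (B k)) atTop (𝓝 (volume (∅ : Set (E n)))) := by
    refine tendsto_measure_of_ae_tendsto_indicator atTop MeasurableSet.empty hB
      h.domain.isOpen.measurableSet h.domain.isBounded.measure_lt_top.ne
      (Eventually.of_forall fun k x hx => by_contra fun hxΩ =>
        hx.2.not_ge (h.reflDiff_nonneg_of_notMem hxΩ _)) ?_
    have hne : ∀ᵐ x : E n, x 0 ≠ l₀ :=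
      (measure_eq_zero_iff_ae_notMem.1 (volume_hyperplane l₀)).mono fun x hx => hx
    filter_upwards [hlim, h.reflDiff_pos hl₀ hw, hne] with x hx hpos hxl
    simp only [Set.mem_empty_iff_false, iff_false]
    rcases lt_or_gt_of_ne hxl with hlt | hgt
    · filter_upwards [hlφ.eventually (lt_mem_nhds hlt)] with k hk hxB
      exact hxB.1.not_gt hk
    · by_cases hxΩ : x ∈ Ω
      · filter_upwards [hx.eventually (lt_mem_nhds (hpos hxΩ hgt))] with k hk hxB
        exact hxB.2.not_gt hk
      · exact Eventually.of_forall fun k hxB =>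
          hxB.2.not_ge (h.reflDiff_nonneg_of_notMem hxΩ _)
  rw [measure_empty] at hlimB
  obtain ⟨k, hk⟩ := (hlimB.eventually (gt_mem_nhds hδ)).exists
  exact (hbad (φ k)).2 (hsmall _ (hbad (φ k)).1.le hk)

/-- The method of moving planes: the hyperplane can be moved from infinity to the origin. -/
lemma reflDiff_nonneg (h : PositiveSolution J Ω f u L) {l : ℝ} (hl : 0 ≤ l) :
    ∀ᵐ x, l < x 0 → 0 ≤ reflDiff l u x := by
  have hsub : Set.Ioi (0 : ℝ) ⊆ {l : ℝ | 0 < l ∧ ∀ᵐ x, l < x 0 → 0 ≤ reflDiff l u x} := by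
    refine isPreconnected_Ioi.subset_of_closure_inter_subset h.isOpen_setOf_reflDiff_nonneg ?_
      fun l hl => ⟨hl.2, h.reflDiff_nonneg_of_mem_closure hl.1⟩
    -- far out, the half space does not meet `Ω`
    obtain ⟨R, hR⟩ := h.domain.isBounded.exists_norm_le
    have hpos : 0 < |R| + 1 := by positivity
    refine ⟨|R| + 1, hpos, hpos, ae_of_all _ fun x hx =>
      h.reflDiff_nonneg_of_notMem (fun hxΩ => ?_) _⟩
    linarith [hR x hxΩ, abs_first_le x, le_abs_self (x 0), le_abs_self R]
  refine h.reflDiff_nonneg_of_mem_closure (closure_mono hsub ?_)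
  rw [closure_Ioi]
  exact hl

lemma refl_zero_mem_iff (h : PositiveSolution J Ω f u L) {x : E n} : refl 0 x ∈ Ω ↔ x ∈ Ω := by
  have hmem {x : E n} (hx : x ∈ Ω) : refl 0 x ∈ Ω := h.domain.pt_mem hx (by simp)
  exact ⟨fun hx => by simpa using hmem hx, hmem⟩

/-- The reflection of a solution at `{x_1 = 0}` is a solution of the same problem. -/
lemma comp_refl_zero (h : PositiveSolution J Ω f u L) :
    PositiveSolution J Ω f (fun x => u (refl 0 x)) L := by
  have hf_le {x : E n} (hx : x ∈ Ω) (τ : ℝ) : f x τ ≤ f (refl 0 x) τ := by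
    have := h.monotone τ x hx (-1) (by simp)
    simpa [refl] using this
  have hf {x : E n} (hx : x ∈ Ω) (τ : ℝ) : f (refl 0 x) τ = f x τ :=
    le_antisymm (by simpa using hf_le (h.refl_zero_mem_iff.2 hx) τ) (hf_le hx τ)
  have hpre : refl 0 ⁻¹' Ω = Ω := Set.ext fun x => h.refl_zero_mem_iff
  have hΩm := h.domain.isOpen.measurableSet
  have hE := h.finiteEnergy.comp_refl h.kernel 0
  obtain ⟨C, hC⟩ := h.bounded
  have hφD {φ : E n → ℝ} (hφ : MemD J Ω φ) : MemD J Ω (fun x => φ (refl 0 x)) := by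
    refine ⟨hφ.measurable.comp_quasiMeasurePreserving
      (measurePreserving_refl 0).quasiMeasurePreserving, ?_,
      fun x hx => hφ.eq_zero _ (by rwa [h.refl_zero_mem_iff])⟩
    have heq : energy J (fun x => φ (refl 0 x)) = energy J φ := by
      unfold energy
      rw [← (measurePreserving_prod_refl 0).lintegral_comp_emb (measurableEmbedding_prod_refl 0)]
      simp [h.kernel.refl_sub]
    rw [heq]
    exact hφ.energy_lt_top
  refine ⟨h.kernel, h.kernel_strict, h.domain, h.monotone, ⟨⟨hE.measurable.aemeasurable,
    (finiteEnergy_iff_energy_lt_top h.kernel hE.measurable).1 hE,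
    fun x hx => h.eq_zero (by rwa [h.refl_zero_mem_iff])⟩, fun φ hφ => ?_, fun φ hφ => ?_⟩,
    hE.measurable, fun x => h.nonneg _, ⟨C, fun x => hC _⟩, ?_, h.lipschitz_nonneg,
    fun x hx y z => h.lipschitz x hx _ _⟩
  · have h1 := h.solution.integrable _ (hφD hφ)
    rw [← (measurePreserving_refl 0).integrableOn_comp_preimage (measurableEmbedding_refl 0),
      hpre] at h1
    refine h1.congr_fun (fun x hx => ?_) hΩm
    simp [hf hx]
  · rw [form_comp_refl h.kernel, h.solution.eq _ (hφD hφ),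
      ← (measurePreserving_refl 0).setIntegral_preimage_emb (measurableEmbedding_refl 0), hpre]
    refine setIntegral_congr_fun hΩm fun x hx => ?_
    simp [hf hx]
  · filter_upwards [(measurePreserving_refl 0).quasiMeasurePreserving.ae h.pos] with x hx hxΩ
    exact hx (h.refl_zero_mem_iff.2 hxΩ)

lemma ae_refl_zero_eq (h : PositiveSolution J Ω f u L) : ∀ᵐ x, u (refl 0 x) = u x := by
  have hpos : ∀ᵐ x : E n, 0 < x 0 → u (refl 0 x) = u x := by
    filter_upwards [h.reflDiff_nonneg le_rfl, h.comp_refl_zero.reflDiff_nonneg le_rfl]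
      with x h1 h2 hx
    have h1 := h1 hx
    have h2 := h2 hx
    simp only [reflDiff, refl_refl] at h1 h2
    linarith
  filter_upwards [hpos, (measurePreserving_refl 0).quasiMeasurePreserving.ae hpos] with x h1 h2
  rcases lt_trichotomy (x 0) 0 with hx | hx | hx
  · have := h2 (by simpa using hx)
    rw [refl_refl] at this
    exact this.symm
  · rw [show refl 0 x = x from ext_first_rest (by simp [hx]) (by simp)]
  · exact h1 hx

lemma exists_le_reflDiff_of_one_lt_div (h : PositiveSolution J Ω f u L) {l : ℝ} (hl : l ≠ 0)
    {x₀ : E n} (hx₀ : x₀ ∈ Ω) (hx₀l : 1 < x₀ 0 / l) :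
    ∃ r ε : ℝ, 0 < r ∧ 0 < ε ∧ ∀ᵐ x, x ∈ Metric.ball x₀ r → ε ≤ reflDiff l u x := by
  rcases lt_or_gt_of_ne hl with hneg | hpos
  · have hx : -l < refl 0 x₀ 0 := by
      rw [one_lt_div_of_neg hneg] at hx₀l
      simp only [refl_first]
      linarith
    obtain ⟨r, ε, hr, hε, hle⟩ := h.exists_le_reflDiff (neg_pos.2 hneg)
      (h.reflDiff_nonneg (neg_pos.2 hneg).le) (h.refl_zero_mem_iff.2 hx₀) hx
    refine ⟨r, ε, hr, hε, ?_⟩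
    filter_upwards [(measurePreserving_refl 0).quasiMeasurePreserving.ae hle, h.ae_refl_zero_eq,
      (measurePreserving_refl l).quasiMeasurePreserving.ae h.ae_refl_zero_eq] with x h1 h2 h3 hxr
    have h4 := h1 (by
      rw [Metric.mem_ball, (isometry_refl 0).dist_eq]
      exact hxr)
    have h5 : refl (-l) (refl 0 x) = refl 0 (refl l x) :=
      ext_first_rest (by simp only [refl_first]; ring) (by simp)
    rw [reflDiff, h5, h2, h3] at h4
    exact h4
  · exact h.exists_le_reflDiff hpos (h.reflDiff_nonneg hpos.le) hx₀ ((one_lt_div hpos).1 hx₀l)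

/-- Each point of `Ω` is the reflection, at some `{x_1 = l}` with `l > 0`, of a point of `Ω` farther
to the right, so strict monotonicity yields strict positivity. -/
lemma exists_le_self (h : PositiveSolution J Ω f u L) {x₀ : E n} (hx₀ : x₀ ∈ Ω) :
    ∃ r ε : ℝ, 0 < r ∧ 0 < ε ∧ ∀ᵐ x, x ∈ Metric.ball x₀ r → ε ≤ u x := by
  obtain ⟨t, ht, htΩ⟩ : ∃ t, |x₀ 0| < t ∧ pt t (rest x₀) ∈ Ω := by
    have hc : Continuous fun t : ℝ => (pt t (rest x₀) : E n) := by
      have : Continuous fun t : ℝ => refl (t / 2 + x₀ 0 / 2) x₀ :=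
        continuous_uncurry_refl.comp (by fun_prop : Continuous fun t : ℝ => (t / 2 + x₀ 0 / 2, x₀))
      convert this using 2 with t
      exact ext_first_rest (by simp only [pt_zero, refl_first]; ring) (by simp)
    have hmem := (h.domain.isOpen.preimage hc).mem_nhds
      (show |x₀ 0| ∈ _ from h.domain.pt_mem hx₀ (abs_abs _).le)
    obtain ⟨s, hs, hsub⟩ := Metric.mem_nhds_iff.1 hmem
    refine ⟨|x₀ 0| + s / 2, by linarith, hsub ?_⟩
    rw [Metric.mem_ball, Real.dist_eq, add_sub_cancel_left, abs_of_pos (half_pos hs)]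
    exact half_lt_self hs
  obtain ⟨h1, h2⟩ := abs_lt.1 ht
  have hl : 0 < (t + x₀ 0) / 2 := by linarith
  obtain ⟨r, ε, hr, hε, hle⟩ := h.exists_le_reflDiff hl (h.reflDiff_nonneg hl.le) htΩ
    (by rw [pt_zero]; linarith)
  have heq : pt t (rest x₀) = refl ((t + x₀ 0) / 2) x₀ :=
    ext_first_rest (by simp only [pt_zero, refl_first]; ring) (by simp)
  refine ⟨r, ε, hr, hε, ?_⟩
  filter_upwards [(measurePreserving_refl ((t + x₀ 0) / 2)).quasiMeasurePreserving.ae hle]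
    with x hx hxr
  have h3 := hx (by
    rw [heq, Metric.mem_ball, (isometry_refl _).dist_eq]
    exact hxr)
  rw [reflDiff, refl_refl] at h3
  linarith [h.nonneg (refl ((t + x₀ 0) / 2) x)]

end PositiveSolution

/-- A locally uniform a.e. positive lower bound gives a positive essential infimum on compact
sets. -/
lemma essInfOn_pos {g : E n → ℝ} {K : Set (E n)} (hK : IsCompact K)
    (h : ∀ x ∈ K, ∃ r ε : ℝ, 0 < r ∧ 0 < ε ∧ ∀ᵐ y, y ∈ Metric.ball x r → ε ≤ g y) :
    0 < essInfOn g K := by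
  obtain ⟨ε, hε, hle⟩ : ∃ ε : ℝ, 0 < ε ∧ ∀ᵐ y, y ∈ K → ε ≤ g y := by
    refine hK.induction_on (p := fun s => ∃ ε : ℝ, 0 < ε ∧ ∀ᵐ y, y ∈ s → ε ≤ g y)
      ⟨1, one_pos, by simp⟩ ?_ ?_ ?_
    · rintro s t hst ⟨ε, hε, hle⟩
      exact ⟨ε, hε, hle.mono fun y hy hys => hy (hst hys)⟩
    · rintro s t ⟨ε₁, hε₁, h₁⟩ ⟨ε₂, hε₂, h₂⟩
      refine ⟨min ε₁ ε₂, lt_min hε₁ hε₂, ?_⟩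
      filter_upwards [h₁, h₂] with y hy₁ hy₂ hy
      exact hy.elim (fun hy => (min_le_left _ _).trans (hy₁ hy))
        fun hy => (min_le_right _ _).trans (hy₂ hy)
    · intro x hx
      obtain ⟨r, ε, hr, hε, hle⟩ := h x hx
      exact ⟨_, mem_nhdsWithin_of_mem_nhds (Metric.ball_mem_nhds x hr), ε, hε, hle⟩
  have hpos : (0 : EReal) < ε := EReal.coe_pos.2 hε
  refine hpos.trans_le (le_essInf_of_ae_le _ ?_)
  filter_upwards [(ae_restrict_iff' hK.measurableSet).2 hle] with y hy
  exact EReal.coe_le_coe_iff.2 hy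

end

/-! ### Reduction to regular representatives and conclusion -/

section

variable {n : ℕ} {J : E n → ℝ} {Ω : Set (E n)} {f : E n → ℝ → ℝ} {u : E n → ℝ}

lemma ae_sub_eq {J' : E n → ℝ} (hJ : J =ᵐ[volume] J') :
    ∀ᵐ p : E n × E n, J (p.1 - p.2) = J' (p.1 - p.2) :=
  (quasiMeasurePreserving_sub_of_right_invariant volume volume).ae hJ

lemma energy_congr {J' u' : E n → ℝ} (hJ : J =ᵐ[volume] J') (hu : u =ᵐ[volume] u') :
    energy J u = energy J' u' := by
  unfold energy
  congr 1
  refine lintegral_congr_ae ?_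
  filter_upwards [ae_sub_eq hJ, Measure.quasiMeasurePreserving_fst.ae hu,
    Measure.quasiMeasurePreserving_snd.ae hu] with p h1 h2 h3
  rw [h1, h2, h3]

lemma form_congr {J' u' : E n → ℝ} (hJ : J =ᵐ[volume] J') (hu : u =ᵐ[volume] u') (φ : E n → ℝ) :
    form J u φ = form J' u' φ := by
  unfold form
  congr 1
  refine integral_congr_ae ?_
  filter_upwards [ae_sub_eq hJ, Measure.quasiMeasurePreserving_fst.ae hu,
    Measure.quasiMeasurePreserving_snd.ae hu] with p h1 h2 h3
  rw [h1, h2, h3]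

lemma memD_congr {J' u' : E n → ℝ} (hJ : J =ᵐ[volume] J') (hu : u =ᵐ[volume] u')
    (h0 : ∀ x, x ∉ Ω → u' x = 0) (h : MemD J Ω u) : MemD J' Ω u' :=
  ⟨h.measurable.congr hu, by rw [← energy_congr hJ hu]; exact h.energy_lt_top, h0⟩

lemma isSolution_congr {J' u' : E n → ℝ} (hJ : J =ᵐ[volume] J') (hu : u =ᵐ[volume] u')
    (h0 : ∀ x, x ∉ Ω → u' x = 0) (h : IsSolution J Ω f u) : IsSolution J' Ω f u' := by
  have hφ {φ : E n → ℝ} (hφ : MemD J' Ω φ) : MemD J Ω φ :=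
    memD_congr hJ.symm (ae_eq_refl φ) hφ.eq_zero hφ
  have hf (φ : E n → ℝ) : (fun x => f x (u x) * φ x)
      =ᵐ[volume.restrict Ω] fun x => f x (u' x) * φ x := by
    filter_upwards [ae_restrict_of_ae hu] with x hx
    rw [hx]
  refine ⟨memD_congr hJ hu h0 h.memD, fun φ h' => (h.integrable φ (hφ h')).congr (hf φ),
    fun φ h' => ?_⟩
  rw [← form_congr hJ hu, h.eq φ (hφ h'), integral_congr_ae (hf φ)]

/-- The kernel with the value at the origin changed to `0`. -/
noncomputable def zeroAtOrigin (J : E n → ℝ) (z : E n) : ℝ := if z = 0 then 0 else J z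

lemma zeroAtOrigin_of_ne {z : E n} (hz : z ≠ 0) : zeroAtOrigin J z = J z := if_neg hz

lemma zeroAtOrigin_ae_eq : zeroAtOrigin J =ᵐ[volume] J :=
  (Measure.ae_ne volume 0).mono fun _ hz => zeroAtOrigin_of_ne hz

lemma KernelMonotone.le (h : KernelMonotone J) {z y : E n} (hz : z ≠ 0) (hzy : rest z = rest y)
    (hle : |z 0| ≤ |y 0|) : J y ≤ J z := by
  have := h.1 (rest z) (z 0) (y 0) (by rwa [pt_rest]) hle
  rwa [pt_rest, hzy, pt_rest] at this

lemma ne_zero_of_abs_first_le {z y : E n} (hz : z ≠ 0) (hzy : rest z = rest y)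
    (hle : |z 0| ≤ |y 0|) : y ≠ 0 := by
  rintro rfl
  refine hz (ext_first_rest ?_ hzy)
  simpa using hle

lemma levyKernel_zeroAtOrigin (hJ : EvenKernel J) (hJ1 : KernelIntegrability J)
    (hJ2 : KernelMonotone J) : LevyKernel (zeroAtOrigin J) := by
  have hnn (z : E n) : 0 ≤ zeroAtOrigin J z := by
    unfold zeroAtOrigin
    split_ifs with hz
    exacts [le_rfl, hJ.nonneg z hz]
  have hm : AEMeasurable (zeroAtOrigin J) := hJ.measurable.congr zeroAtOrigin_ae_eq.symm
  refine ⟨hm, hnn, fun z => ?_, fun z => ?_, fun z y hz hzy hle => ?_, ⟨?_, ?_⟩, ?_⟩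
  · rcases eq_or_ne z 0 with rfl | hz
    · simp
    · rw [zeroAtOrigin_of_ne hz, zeroAtOrigin_of_ne (neg_ne_zero.2 hz), hJ.even z hz]
  · rcases eq_or_ne z 0 with rfl | hz
    · rw [show refl 0 (0 : E n) = 0 from ext_first_rest (by simp) (by simp)]
    · have habs : |refl 0 z 0| = |z 0| := by simp
      have hz' : refl 0 z ≠ 0 := ne_zero_of_abs_first_le hz (by simp) habs.ge
      rw [zeroAtOrigin_of_ne hz, zeroAtOrigin_of_ne hz']
      exact le_antisymm (hJ2.le hz (by simp) habs.ge) (hJ2.le hz' (by simp) habs.le)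
  · rw [zeroAtOrigin_of_ne hz, zeroAtOrigin_of_ne (ne_zero_of_abs_first_le hz hzy hle)]
    exact hJ2.le hz hzy hle
  · exact ((by fun_prop : Measurable fun z : E n => min 1 (‖z‖ ^ 2)).aemeasurable.mul
      hm).aestronglyMeasurable
  · rw [hasFiniteIntegral_iff_ofReal (ae_of_all _ fun z =>
      mul_nonneg (le_min zero_le_one (sq_nonneg _)) (hnn z)),
      ← lintegral_add_compl _ (Metric.isOpen_ball (x := (0 : E n)) (ε := 1)).measurableSet]
    refine lt_of_le_of_lt ?_ hJ1.1
    rw [add_comm]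
    refine add_le_add ?_ ?_
    · refine lintegral_mono_ae (ae_restrict_of_ae ?_)
      filter_upwards [zeroAtOrigin_ae_eq (J := J)] with z hz
      rw [← hz]
      exact ENNReal.ofReal_le_ofReal (mul_le_of_le_one_left (hnn z) (min_le_left _ _))
    · refine lintegral_mono_ae (ae_restrict_of_ae ?_)
      filter_upwards [zeroAtOrigin_ae_eq (J := J)] with z hz
      rw [← hz]
      exact ENNReal.ofReal_le_ofReal (mul_le_mul_of_nonneg_right (min_le_right _ _) (hnn z))
  · rw [← hJ1.2]
    refine lintegral_congr_ae ?_
    filter_upwards [zeroAtOrigin_ae_eq (J := J)] with z hz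
    rw [hz]

/-- Monotonicity extends the strict inequality to all comparison points, however far out. -/
lemma exists_zeroAtOrigin_lt (hJ2 : KernelMonotone J) :
    ∃ r₀ : ℝ, 0 < r₀ ∧ ∀ z y : E n, z ≠ 0 → rest z = rest y → ‖rest z‖ < r₀ →
      |z 0| < |y 0| → |z 0| < r₀ → zeroAtOrigin J y < zeroAtOrigin J z := by
  obtain ⟨r₀, hr₀, hlt⟩ := hJ2.2
  refine ⟨r₀, hr₀, fun z y hz hzy hrest hzy0 hzr => ?_⟩
  rw [zeroAtOrigin_of_ne hz, zeroAtOrigin_of_ne (ne_zero_of_abs_first_le hz hzy hzy0.le)]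
  let t : ℝ := min |y 0| r₀
  have hzt : |z 0| < t := lt_min hzy0 hzr
  have ht : |t| = t := abs_of_pos ((abs_nonneg _).trans_lt hzt)
  have h1 := hlt (rest z) (z 0) t (by rwa [pt_rest]) hrest.le (by rwa [ht])
    (by rw [ht]; exact min_le_right _ _)
  rw [pt_rest] at h1
  refine lt_of_le_of_lt (hJ2.le ?_ (by simp [hzy]) ?_) h1
  · exact ne_zero_of_abs_first_le hz (by simp) (by rw [pt_zero, ht]; exact hzt.le)
  · rw [pt_zero, ht]
    exact min_le_left _ _

/-- A positive bounded solution agrees a.e. with a representative that is measurable, nonnegative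
and bounded everywhere. -/
lemma exists_positiveSolution (hΩ : SteinerDomain Ω) (hJ : EvenKernel J)
    (hJ1 : KernelIntegrability J) (hJ2 : KernelMonotone J) (hf1 : CaratheodoryLipschitz Ω f)
    (hf2 : NonlinearityMonotone Ω f) (hu : IsSolution J Ω f u)
    (hu_bdd : MemLp u ⊤ (volume.restrict Ω)) (hu_pos : ∀ᵐ x ∂(volume.restrict Ω), 0 < u x) :
    ∃ (u' : E n → ℝ) (L : ℝ), u =ᵐ[volume] u' ∧ PositiveSolution (zeroAtOrigin J) Ω f u' L := by
  have hΩm := hΩ.isOpen.measurableSet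
  let C : ℝ := (eLpNorm u ⊤ (volume.restrict Ω)).toReal
  have hC : ∀ᵐ x, x ∈ Ω → u x ≤ C := by
    refine (ae_restrict_iff' hΩm).1 ?_
    have := ae_le_eLpNormEssSup (f := u) (μ := volume.restrict Ω)
    filter_upwards [this] with x hx
    rw [← eLpNorm_exponent_top] at hx
    have h2 := ENNReal.toReal_mono hu_bdd.2.ne hx
    rw [toReal_enorm] at h2
    exact (le_abs_self _).trans h2
  have hC0 : 0 ≤ C := ENNReal.toReal_nonneg
  have hpos := (ae_restrict_iff' hΩm).1 hu_pos
  let g : E n → ℝ := hu.memD.measurable.mk u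
  have hg : Measurable g := hu.memD.measurable.measurable_mk
  let u' : E n → ℝ := Ω.indicator fun x => max 0 (min C (g x))
  have hu'Ω {x : E n} (hx : x ∈ Ω) : u' x = max 0 (min C (g x)) := Set.indicator_of_mem hx _
  have hu'0 (x : E n) (hx : x ∉ Ω) : u' x = 0 := Set.indicator_of_notMem hx _
  have hmem (x : E n) : u' x ∈ Set.Icc 0 C := by
    by_cases hx : x ∈ Ω
    · rw [hu'Ω hx]
      exact ⟨le_max_left _ _, max_le hC0 (min_le_left _ _)⟩
    · rw [hu'0 x hx]
      exact ⟨le_rfl, hC0⟩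
  have huu' : u =ᵐ[volume] u' := by
    filter_upwards [hC, hpos, hu.memD.measurable.ae_eq_mk] with x h1 h2 h3
    by_cases hx : x ∈ Ω
    · rw [hu'Ω hx, show g x = u x from h3.symm, min_eq_right (h1 hx), max_eq_right (h2 hx).le]
    · rw [hu'0 x hx, hu.memD.eq_zero x hx]
  obtain ⟨L, hL0, hL⟩ := hf1.lipschitz (Set.Icc 0 C) (Metric.isBounded_Icc 0 C)
  refine ⟨u', L, huu', levyKernel_zeroAtOrigin hJ hJ1 hJ2, exists_zeroAtOrigin_lt hJ2, hΩ, hf2,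
    isSolution_congr zeroAtOrigin_ae_eq.symm huu' hu'0 hu,
    (measurable_const.max (measurable_const.min hg)).indicator hΩm, fun x => (hmem x).1,
    ⟨C, fun x => (hmem x).2⟩, ?_, hL0.le, fun x hx y z => hL x hx _ (hmem y) _ (hmem z)⟩
  filter_upwards [hpos, huu'] with x h1 h2 hx
  rw [← h2]
  exact h1 hx

end

end NonlocalSymmetry

open NonlocalSymmetry
theorem theorem1p4 (n : ℕ) (Ω : Set (E n)) (hΩ : SteinerDomain Ω)
    (J : E n → ℝ) (hJ : EvenKernel J) (hJ1 : KernelIntegrability J) (hJ2 : KernelMonotone J)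
    (f : E n → ℝ → ℝ) (hf1 : CaratheodoryLipschitz Ω f) (hf2 : NonlinearityMonotone Ω f)
    (u : E n → ℝ) (hu : IsSolution J Ω f u)
    (hu_bdd : MemLp u ⊤ (volume.restrict Ω))
    (hu_pos : ∀ᵐ x ∂(volume.restrict Ω), 0 < u x) :
    SymmetricFirst Ω u ∧ StrictlyDecreasingFirst Ω u ∧
      ∀ K : Set (E n), IsCompact K → K ⊆ Ω → 0 < essInfOn u K := by
  obtain ⟨u', L, huu', h⟩ := exists_positiveSolution hΩ hJ hJ1 hJ2 hf1 hf2 hu hu_bdd hu_pos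
  have hrefl (l : ℝ) : ∀ᵐ x, u (refl l x) = u' (refl l x) :=
    (measurePreserving_refl l).quasiMeasurePreserving.ae huu'
  refine ⟨ae_restrict_of_ae ?_, fun l hl K hK hKΩ => essInfOn_pos hK fun x hx => ?_,
    fun K hK hKΩ => essInfOn_pos hK fun x hx => ?_⟩
  · filter_upwards [h.ae_refl_zero_eq, huu', hrefl 0] with x h1 h2 h3
    have h4 : refl 0 x = pt (-(x 0)) (rest x) := ext_first_rest (by simp) (by simp)
    rw [← h4, h3, h1, h2]
  · obtain ⟨r, ε, hr, hε, hle⟩ :=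
      h.exists_le_reflDiff_of_one_lt_div hl (hKΩ hx).1 (hKΩ hx).2
    refine ⟨r, ε, hr, hε, ?_⟩
    filter_upwards [hle, huu', hrefl l] with y h1 h2 h3 hy
    have h4 := h1 hy
    rw [reflDiff, ← h2, ← h3] at h4
    exact h4
  · obtain ⟨r, ε, hr, hε, hle⟩ := h.exists_le_self (hKΩ hx)
    refine ⟨r, ε, hr, hε, ?_⟩
    filter_upwards [hle, huu'] with y h1 h2 hy
    rw [h2]
    exact h1 hy
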